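/- Let $x_1,\dots,x_n\in\mathbb R^p$. Tyler's M-estimator $\hat\Sigma$ of $x_1,\dots,x_n$ is the unique positive definite $p\times p$ matrix satisfying $$\hat\Sigma=\frac pn\sum_{i=1}^n\frac{x_ix_i^T}{x_i^T\hat\Sigma^{-1}x_i},\qquad \operatorname{tr}(\hat\Sigma)=1;$$ it is called well defined when there is exactly one such matrix. Let $S_n=\frac1n\sum_{i=1}^n x_ix_i^T$ and let $\|\cdot\|$ denote the operator (spectral) norm. **Theorem.** Let $0<y<1$. (1) There exist constants $C,c,c',\delta>0$, depending only on $y$, such that for all integers $n\ge 1$ and $p\ge 0$ with $|p/n-y|<\delta$ (in particular whenever $p/n=y$), if $x_1,\dots,x_n$ are i.i.d. with law $N(0,I)$ on $\mathbb R^p$, then for every $0<\varepsilon<c'$, with probability at least $1-Cne^{-c\varepsilon^2n}$, Tyler's M-estimator $\hat\Sigma$ is well defined and $$\Big\|p\,\hat\Sigma-\frac1n\sum_{i=1}^n x_ix_i^T\Big\|\le\varepsilon .$$ Here "with probability at least $1-\eta$" means that the exceptional event has (outer) probability at most $\eta$. (2) Let $(n_k)$ be a strictly increasing sequence of nonnegative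 integers and $(p_k)$ a sequence of nonnegative integers with $p_k/n_k\to y$ (in particular, $p_k/n_k=y$ for all $k$). On one probability space let, for every $k$, $x^{(k)}_1,\dots,x^{(k)}_{n_k}$ be i.i.d. with law $N(0,I)$ on $\mathbb R^{p_k}$, with arbitrary dependence between different $k$. Then almost surely Tyler's M-estimator $\hat\Sigma_k$ of the $k$-th sample is well defined for all large $k$, and $$\Big\|p_k\,\hat\Sigma_k-\frac1{n_k}\sum_{i=1}^{n_k}x^{(k)}_i(x^{(k)}_i)^T\Big\|\longrightarrow 0\qquad(k\to\infty).$$ -/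

import Mathlib

open MeasureTheory ProbabilityTheory Filter Topology
open scoped Matrix Matrix.Norms.L2Operator

universe u

/-- The sample covariance matrix `(1/n) ∑ xᵢ xᵢᵀ` of `x₁, …, xₙ ∈ ℝᵖ` (no centering). -/
noncomputable def sampleCovariance {n p : ℕ} (x : Fin n → EuclideanSpace ℝ (Fin p)) :
    Matrix (Fin p) (Fin p) ℝ :=
  (1 / (n : ℝ)) • ∑ i, Matrix.vecMulVec (x i).ofLp (x i).ofLp

/-- `S` is a positive definite solution of Tyler's equation
`S = (p/n) ∑ xᵢ xᵢᵀ / (xᵢᵀ S⁻¹ xᵢ)` with `tr S = 1`. -/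
structure IsTylerEstimator {n p : ℕ} (x : Fin n → EuclideanSpace ℝ (Fin p))
    (S : Matrix (Fin p) (Fin p) ℝ) : Prop where
  posDef : S.PosDef
  equation : S = ((p : ℝ) / (n : ℝ)) •
    ∑ i, ((x i).ofLp ⬝ᵥ (S⁻¹ *ᵥ (x i).ofLp))⁻¹ • Matrix.vecMulVec (x i).ofLp (x i).ofLp
  trace_eq_one : S.trace = 1

/-- Tyler's M-estimator is well defined for the data `x`: Tyler's equation has exactly one
solution of trace one. -/
def HasTylerEstimator {n p : ℕ} (x : Fin n → EuclideanSpace ℝ (Fin p)) : Prop :=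
  ∃! S : Matrix (Fin p) (Fin p) ℝ, IsTylerEstimator x S

open Classical in
/-- Tyler's M-estimator: the unique solution of Tyler's equation of trace one
(the zero matrix where it is not well defined). -/
noncomputable def tylerEstimator {n p : ℕ} (x : Fin n → EuclideanSpace ℝ (Fin p)) :
    Matrix (Fin p) (Fin p) ℝ :=
  if h : HasTylerEstimator x then h.choose else 0

/-- `x₁, …, xₙ` are i.i.d. random vectors with law `N(0, I)` on `ℝᵖ`. -/
structure IsStdGaussianSample {Ω : Type*} [MeasurableSpace Ω] (μ : Measure Ω) {n p : ℕ}
    (x : Fin n → Ω → EuclideanSpace ℝ (Fin p)) : Prop where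
  hasLaw : ∀ i, HasLaw (x i) (stdGaussian (EuclideanSpace ℝ (Fin p))) μ
  indep : iIndepFun x μ

/-! A solution of Tyler's equation is a weighted Gram matrix `∑ wᵢ xᵢ xᵢᵀ`, so the equation says
that the positive weights are stationary: `wᵢ · lev X w i i = p / n` for all `i`. For `w = 1` the
leverages are the entries of the projection matrix `H` onto the column space of the data matrix, and
its diagonal concentrates at `p / n`. Constant weights are thus nearly stationary, and the task is
to show that this forces exactly stationary weights to exist, to be unique up to scale, and to be
nearly constant.

Stability (`one_sub_div_mul_le`): let `w` have its maximum `M` at `i` and its minimum `m` at `k`.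
Comparing with unit weights gives `∑ⱼ (1 - wⱼ/M) Hᵢⱼ² ≤ η` and `∑ⱼ (1 - m/wⱼ) Hₖⱼ² ≤ η`, where `η`
bounds the deviation of the diagonal of `H` from `p / n`. The two brackets sum to at least `1 -
m/M`, so if any two rows of `H` overlap, `∑ⱼ min(Hᵢⱼ², Hₖⱼ²) ≥ c`, then `1 - m/M ≤ 2η/c`. Existence
follows by minimising a scale invariant potential over a box, where the same estimate keeps the
minimiser off the boundary after rescaling. For uniqueness the comparison is applied to two
stationary weights, where it becomes an equality. The trace and `‖X‖² = O(n)` then turn nearly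
constant weights into the norm bound (`hasTylerEstimator_and_norm_sub_le`).

Probability enters through rotation invariance. A leverage has the law of `uᵀHu` for every unit `u`;
averaging over a Gaussian direction makes it a ratio of chi-squares (`stdGaussian_leverage_le`). The
off-diagonal part of a row of `H` has a uniform direction, as does a Gaussian vector with one
coordinate erased, so most of its coordinates have order `n^(-1/2)` (`stdGaussian_spread_le`) and
two rows must overlap. Full rank and the operator norm bound come from a Fubini form of the net
argument (`pow_mul_measure_le_of_forall_ball`). Almost sure convergence is Borel–Cantelli. -/

/-! ### Weighted Gram matrices and leverages -/

/-- The weighted Gram matrix `∑ wᵢ xᵢ xᵢᵀ` of the rows `xᵢ` of `X`. -/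
noncomputable def wgram {ι κ : Type*} [Fintype ι] (X : ι → κ → ℝ) (w : ι → ℝ) :
    Matrix κ κ ℝ :=
  ∑ i, w i • Matrix.vecMulVec (X i) (X i)

/-- The bilinear leverage `xᵢᵀ (∑ wₗ xₗ xₗᵀ)⁻¹ xⱼ`. -/
noncomputable def lev {ι κ : Type*} [Fintype ι] [Fintype κ] [DecidableEq κ] (X : ι → κ → ℝ)
    (w : ι → ℝ) (i j : ι) : ℝ :=
  X i ⬝ᵥ (wgram X w)⁻¹ *ᵥ X j

section Gram

set_option linter.unusedSectionVars false

variable {ι κ : Type*} [Fintype ι] [Fintype κ] [DecidableEq κ] (X : ι → κ → ℝ)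

lemma wgram_mulVec (w : ι → ℝ) (u : κ → ℝ) :
    wgram X w *ᵥ u = ∑ j, (w j * (X j ⬝ᵥ u)) • X j := by
  rw [wgram, Matrix.sum_mulVec]
  refine Finset.sum_congr rfl fun j _ => ?_
  rw [Matrix.smul_mulVec, Matrix.vecMulVec_mulVec, mul_smul]
  simp

lemma dotProduct_wgram_mulVec (w : ι → ℝ) (u v : κ → ℝ) :
    u ⬝ᵥ wgram X w *ᵥ v = ∑ j, w j * (X j ⬝ᵥ u) * (X j ⬝ᵥ v) := by
  rw [wgram_mulVec, dotProduct_sum]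
  refine Finset.sum_congr rfl fun j _ => ?_
  rw [dotProduct_smul, dotProduct_comm u, smul_eq_mul]; ring

lemma wgram_isHermitian (w : ι → ℝ) : (wgram X w).IsHermitian := by
  ext a b
  simp [wgram, Matrix.sum_apply, Matrix.vecMulVec_apply, mul_comm]

lemma wgram_smul (t : ℝ) (w : ι → ℝ) : wgram X (t • w) = t • wgram X w := by
  simp [wgram, Finset.smul_sum, mul_smul]

lemma wgram_trace (w : ι → ℝ) : (wgram X w).trace = ∑ i, w i * (X i ⬝ᵥ X i) := by
  simp [wgram, Matrix.trace_sum, Matrix.trace_vecMulVec]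

variable {X}

lemma wgram_posDef {w : ι → ℝ} (hw : ∀ i, 0 < w i) (hX : (wgram X 1).det ≠ 0) :
    (wgram X w).PosDef := by
  refine Matrix.PosDef.of_dotProduct_mulVec_pos (wgram_isHermitian X w) fun u hu => ?_
  rw [star_trivial, dotProduct_wgram_mulVec]
  have h0 : ∀ j ∈ Finset.univ, 0 ≤ w j * (X j ⬝ᵥ u) * (X j ⬝ᵥ u) := fun j _ => by
    rw [mul_assoc]; exact mul_nonneg (hw j).le (mul_self_nonneg _)
  refine lt_of_le_of_ne (Finset.sum_nonneg h0) fun h => hu ?_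
  have h1 := (Finset.sum_eq_zero_iff_of_nonneg h0).1 h.symm
  have h2 : ∀ j, X j ⬝ᵥ u = 0 := fun j => by
    have := h1 j (Finset.mem_univ j)
    rcases mul_eq_zero.1 this with h | h
    · exact (mul_eq_zero.1 h).resolve_left (hw j).ne'
    · exact h
  by_contra hu0
  exact hX ((Matrix.exists_mulVec_eq_zero_iff).1 ⟨u, hu0, by simp [wgram_mulVec, h2]⟩)

lemma wgram_mulVec_inv {w : ι → ℝ} (h : (wgram X w).PosDef) (u : κ → ℝ) :
    wgram X w *ᵥ (wgram X w)⁻¹ *ᵥ u = u := by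
  rw [Matrix.mulVec_mulVec, Matrix.mul_nonsing_inv _ ((Matrix.isUnit_iff_isUnit_det _).1 h.isUnit),
    Matrix.one_mulVec]

/-- The left side inserts `wgram X w` between its own inverse and `(wgram X v)⁻¹`, where it cancels.
All quadratic expansions of leverages below are evaluated by this identity. -/
lemma sum_lev_mul_lev {w : ι → ℝ} (h : (wgram X w).PosDef) (v : ι → ℝ) (i k : ι) :
    ∑ j, w j * lev X w j i * lev X v j k = lev X v i k := by
  have := dotProduct_wgram_mulVec X w ((wgram X v)⁻¹ *ᵥ X k) ((wgram X w)⁻¹ *ᵥ X i)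
  rw [wgram_mulVec_inv h, dotProduct_comm] at this
  rw [lev, this]
  exact Finset.sum_congr rfl fun j _ => by simp only [lev]; ring

lemma lev_comm (w : ι → ℝ) (i j : ι) : lev X w i j = lev X w j i := by
  rw [lev, lev, Matrix.dotProduct_mulVec, ← Matrix.mulVec_transpose, dotProduct_comm,
    Matrix.transpose_nonsing_inv]
  congr 3
  simpa using (wgram_isHermitian X w).eq

lemma sum_mul_lev_sq {w : ι → ℝ} (h : (wgram X w).PosDef) (i : ι) :
    ∑ j, w j * lev X w i j ^ 2 = lev X w i i := by
  rw [← sum_lev_mul_lev h w i i]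
  exact Finset.sum_congr rfl fun j _ => by rw [lev_comm w i j]; ring

lemma inv_smul_of_posDef {t : ℝ} (ht : t ≠ 0) {A : Matrix κ κ ℝ} (h : A.PosDef) :
    (t • A)⁻¹ = t⁻¹ • A⁻¹ :=
  Matrix.inv_eq_right_inv (by
    rw [Matrix.smul_mul, Matrix.mul_smul, smul_smul, mul_inv_cancel₀ ht, one_smul,
      Matrix.mul_nonsing_inv _ ((Matrix.isUnit_iff_isUnit_det _).1 h.isUnit)])

/-- Comparison of leverages under an upper bound on the weights. -/
lemma sum_upper_deficit_le {v w : ι → ℝ} {M : ℝ} (hM : 0 < M) (hv : (wgram X v).PosDef)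
    (hw0 : ∀ j, 0 < w j) (hw : (wgram X w).PosDef) (i : ι) :
    ∑ j, (v j - w j / M) * lev X v i j ^ 2 ≤ M * lev X w i i - lev X v i i := by
  -- With `a = A_w⁻¹xᵢ` and `b = A_v⁻¹xᵢ`, this is the form `A_w` evaluated at `M a - b`. Unlike the
  -- bare monotonicity of inverses, its expansion records how far each `wⱼ` stays below `M vⱼ`.
  have key : 0 ≤ ∑ j, w j * (M * lev X w j i - lev X v j i) ^ 2 :=
    Finset.sum_nonneg fun j _ => mul_nonneg (hw0 j).le (sq_nonneg _)
  have e : ∑ j, w j * (M * lev X w j i - lev X v j i) ^ 2 =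
      M ^ 2 * (∑ j, w j * lev X w j i * lev X w j i) -
        2 * M * (∑ j, w j * lev X w j i * lev X v j i) + ∑ j, w j * lev X v i j ^ 2 := by
    rw [Finset.mul_sum, Finset.mul_sum, ← Finset.sum_sub_distrib, ← Finset.sum_add_distrib]
    exact Finset.sum_congr rfl fun j _ => by rw [lev_comm v i j]; ring
  rw [e, sum_lev_mul_lev hw, sum_lev_mul_lev hw] at key
  have e2 : ∑ j, (v j - w j / M) * lev X v i j ^ 2 =
      lev X v i i - (∑ j, w j * lev X v i j ^ 2) / M := by
    rw [← sum_mul_lev_sq hv i, Finset.sum_div, ← Finset.sum_sub_distrib]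
    exact Finset.sum_congr rfl fun j _ => by ring
  rw [e2]
  have : (2 * M * lev X v i i - M ^ 2 * lev X w i i) / M ≤ (∑ j, w j * lev X v i j ^ 2) / M := by
    gcongr; linarith
  have e3 : (2 * M * lev X v i i - M ^ 2 * lev X w i i) / M =
    2 * lev X v i i - M * lev X w i i := by field_simp
  linarith

/-- Comparison of leverages under a lower bound on the weights. -/
lemma sum_lower_deficit_le {v w : ι → ℝ} {m : ℝ} (hm : 0 < m) (hv : (wgram X v).PosDef)
    (hw0 : ∀ j, 0 < w j) (hw : (wgram X w).PosDef) (k : ι) :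
    ∑ j, (v j - m * v j ^ 2 / w j) * lev X v k j ^ 2 ≤ lev X v k k - m * lev X w k k := by
  -- The dual principle: the coefficients `vⱼ · lev X v j k` also represent `xₖ` in the rows, and
  -- among such representations `wⱼ · lev X w j k` has the least energy `∑ fⱼ²/wⱼ`.
  have key : 0 ≤ ∑ j, (v j * lev X v j k - w j * lev X w j k) ^ 2 / w j :=
    Finset.sum_nonneg fun j _ => div_nonneg (sq_nonneg _) (hw0 j).le
  have e : ∑ j, (v j * lev X v j k - w j * lev X w j k) ^ 2 / w j =
      (∑ j, v j ^ 2 / w j * lev X v k j ^ 2) -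
        2 * (∑ j, v j * lev X v j k * lev X w j k) + ∑ j, w j * lev X w j k * lev X w j k := by
    rw [Finset.mul_sum, ← Finset.sum_sub_distrib, ← Finset.sum_add_distrib]
    refine Finset.sum_congr rfl fun j _ => ?_
    rw [lev_comm v k j]
    have := (hw0 j).ne'
    field_simp
    ring
  rw [e, sum_lev_mul_lev hw, sum_lev_mul_lev hv] at key
  have e2 : ∑ j, (v j - m * v j ^ 2 / w j) * lev X v k j ^ 2 =
      lev X v k k - m * ∑ j, v j ^ 2 / w j * lev X v k j ^ 2 := by
    rw [← sum_mul_lev_sq hv k, Finset.mul_sum, ← Finset.sum_sub_distrib]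
    exact Finset.sum_congr rfl fun j _ => by ring
  rw [e2]
  nlinarith

/-- The oscillation of weights whose leverages are ordered against the weights is controlled by
the oscillation of the unweighted leverages. -/
lemma one_sub_div_mul_le {w : ι → ℝ} {m M r η c : ℝ} (hm : 0 < m)
    (hw : ∀ j, m ≤ w j ∧ w j ≤ M) (hX : (wgram X 1).det ≠ 0) {i k : ι}
    (hi : M * lev X w i i ≤ r) (hk : r ≤ m * lev X w k k)
    (hhi : r - η ≤ lev X 1 i i) (hhk : lev X 1 k k ≤ r + η)
    (hc : c ≤ ∑ j, min (lev X 1 i j ^ 2) (lev X 1 k j ^ 2)) :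
    (1 - m / M) * c ≤ 2 * η := by
  have hw0 : ∀ j, 0 < w j := fun j => hm.trans_le (hw j).1
  have hM : 0 < M := hm.trans_le ((hw i).1.trans (hw i).2)
  have h1 := wgram_posDef (w := 1) (fun _ => one_pos) hX
  have hA := wgram_posDef hw0 hX
  have u1 := sum_upper_deficit_le hM h1 hw0 hA i
  have u2 := sum_lower_deficit_le hm h1 hw0 hA k
  have hmM : 0 ≤ 1 - m / M := by
    rw [sub_nonneg, div_le_one hM]; exact (hw i).1.trans (hw i).2
  have : (1 - m / M) * ∑ j, min (lev X 1 i j ^ 2) (lev X 1 k j ^ 2) ≤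
      ∑ j, ((1 : ι → ℝ) j - w j / M) * lev X 1 i j ^ 2 +
      ∑ j, ((1 : ι → ℝ) j - m * (1 : ι → ℝ) j ^ 2 / w j) * lev X 1 k j ^ 2 := by
    rw [Finset.mul_sum, ← Finset.sum_add_distrib]
    refine Finset.sum_le_sum fun j _ => ?_
    simp only [Pi.one_apply, one_pow, mul_one]
    have a1 : w j / M ≤ 1 := (div_le_one hM).2 (hw j).2
    have a2 : m / w j ≤ 1 := (div_le_one (hw0 j)).2 (hw j).1
    -- The difference of the two sides is the product of the two nonnegative brackets.
    have a3 : 1 - m / M ≤ (1 - w j / M) + (1 - m / w j) := by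
      have e : (1 - w j / M) * (1 - m / w j) = 1 - w j / M - m / w j + m / M := by
        have := (hw0 j).ne'; field_simp; ring
      nlinarith [mul_nonneg (sub_nonneg.2 a1) (sub_nonneg.2 a2)]
    have b1 := min_le_left (lev X 1 i j ^ 2) (lev X 1 k j ^ 2)
    have b2 := min_le_right (lev X 1 i j ^ 2) (lev X 1 k j ^ 2)
    have b3 : 0 ≤ min (lev X 1 i j ^ 2) (lev X 1 k j ^ 2) := le_min (sq_nonneg _) (sq_nonneg _)
    calc (1 - m / M) * min (lev X 1 i j ^ 2) (lev X 1 k j ^ 2)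
        ≤ ((1 - w j / M) + (1 - m / w j)) * min (lev X 1 i j ^ 2) (lev X 1 k j ^ 2) := by gcongr
      _ = (1 - w j / M) * min (lev X 1 i j ^ 2) (lev X 1 k j ^ 2) +
          (1 - m / w j) * min (lev X 1 i j ^ 2) (lev X 1 k j ^ 2) := by ring
      _ ≤ _ := by
        gcongr
  have := mul_le_mul_of_nonneg_left hc hmM
  linarith

end Gram

/-! ### Existence of stationary weights -/

section Existence

set_option linter.unusedSectionVars false

variable {ι κ : Type*} [Fintype ι] [Fintype κ] [DecidableEq κ] [DecidableEq ι] {X : ι → κ → ℝ}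

lemma wgram_add (v w : ι → ℝ) : wgram X (v + w) = wgram X v + wgram X w := by
  simp [wgram, add_smul, Finset.sum_add_distrib]

lemma wgram_single (i : ι) (a : ℝ) :
    wgram X (Pi.single i a) = a • Matrix.vecMulVec (X i) (X i) := by
  rw [wgram, Finset.sum_eq_single i] <;> simp +contextual

/-- The matrix determinant lemma for a rank-one update; it makes variations of the potential in one
coordinate explicit. -/
lemma det_wgram_add_single {w : ι → ℝ} (h : (wgram X w).PosDef) (i : ι) (a : ℝ) :
    (wgram X (w + Pi.single i a)).det = (wgram X w).det * (1 + a * lev X w i i) := by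
  rw [wgram_add, wgram_single, ← Matrix.smul_vecMulVec, Matrix.vecMulVec_eq Unit,
    Matrix.det_add_replicateCol_mul_replicateRow ((Matrix.isUnit_iff_isUnit_det _).1 h.isUnit)]
  congr 1
  rw [Matrix.det_unique, Matrix.add_apply, Matrix.one_apply_eq, Matrix.mul_assoc,
    ← Matrix.replicateCol_mulVec, Matrix.replicateRow_mul_replicateCol_apply, Matrix.mulVec_smul,
    dotProduct_smul, smul_eq_mul, lev]

/-- The potential whose critical points are the weights of Tyler's estimator. -/
noncomputable def tylerPotential (X : ι → κ → ℝ) (w : ι → ℝ) : ℝ :=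
  Fintype.card ι * Real.log (wgram X w).det - Fintype.card κ * ∑ i, Real.log (w i)

lemma continuousOn_tylerPotential (hX : (wgram X 1).det ≠ 0) :
    ContinuousOn (tylerPotential X) (Set.Icc (fun _ => 1 / 2) (fun _ => 1)) := by
  have hpos : ∀ w ∈ Set.Icc (fun _ : ι => (1 / 2 : ℝ)) (fun _ => 1), ∀ i, 0 < w i :=
    fun w hw i => lt_of_lt_of_le (by norm_num) (hw.1 i)
  unfold tylerPotential
  refine ContinuousOn.sub (continuousOn_const.mul (ContinuousOn.log ?_ fun w hw =>
    (wgram_posDef (hpos w hw) hX).det_pos.ne')) (continuousOn_const.mul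
    (continuousOn_finsetSum _ fun i _ => ContinuousOn.log (by fun_prop) fun w hw =>
      (hpos w hw i).ne'))
  refine Continuous.continuousOn ?_
  refine Continuous.matrix_det ?_
  unfold wgram
  fun_prop

/-- The determinant has degree `p`, so both terms of the potential change by `n p log t`. -/
lemma tylerPotential_smul {t : ℝ} (ht : 0 < t) {w : ι → ℝ} (hw : ∀ i, 0 < w i)
    (hX : (wgram X 1).det ≠ 0) : tylerPotential X (t • w) = tylerPotential X w := by
  have h := (wgram_posDef hw hX).det_pos
  have e : ∀ i, Real.log ((t • w) i) = Real.log t + Real.log (w i) := fun i => by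
    rw [Pi.smul_apply, smul_eq_mul, Real.log_mul ht.ne' (hw i).ne']
  rw [tylerPotential, tylerPotential, wgram_smul, Matrix.det_smul, Real.log_mul (by positivity) h.ne',
    Real.log_pow, Finset.sum_congr rfl fun i _ => e i, Finset.sum_add_distrib, Finset.sum_const,
    Finset.card_univ, nsmul_eq_mul]
  ring

/-- First-order condition under `wᵢ ↦ (1 + s) wᵢ`, with both logarithms linearised by `1 - 1/x ≤ log
x ≤ x - 1`. Dividing by `s` and letting `s → 0` from either side gives the two one-sided
stationarity inequalities. -/
lemma mul_le_of_tylerPotential_le {w : ι → ℝ} (hw : ∀ i, 0 < w i) (hX : (wgram X 1).det ≠ 0)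
    {i : ι} {s : ℝ} (hs : 0 < 1 + s)
    (h : tylerPotential X w ≤ tylerPotential X (w + Pi.single i (s * w i))) :
    Fintype.card κ * s ≤ (Fintype.card ι * (w i * lev X w i i)) * s * (1 + s) := by
  have hw' : ∀ j, 0 < (w + Pi.single i (s * w i) : ι → ℝ) j := fun j => by
    by_cases hj : j = i
    · subst hj; simp only [Pi.add_apply, Pi.single_eq_same]; nlinarith [hw j]
    · simpa [hj] using hw j
  have hA := wgram_posDef hw hX
  have hA' := (wgram_posDef hw' hX).det_pos
  have hd := hA.det_pos
  have e := det_wgram_add_single hA i (s * w i)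
  rw [e] at hA'
  have hpos : 0 < 1 + s * w i * lev X w i i := pos_of_mul_pos_right hA' hd.le
  have es : ∑ j, Real.log ((w + Pi.single i (s * w i) : ι → ℝ) j) =
      ∑ j, Real.log (w j) + Real.log (1 + s) := by
    rw [← Finset.add_sum_erase _ _ (Finset.mem_univ i),
      ← Finset.add_sum_erase _ (fun j => Real.log (w j)) (Finset.mem_univ i)]
    have : ∑ j ∈ Finset.univ.erase i, Real.log ((w + Pi.single i (s * w i) : ι → ℝ) j) =
        ∑ j ∈ Finset.univ.erase i, Real.log (w j) := Finset.sum_congr rfl fun j hj => by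
      simp [Finset.ne_of_mem_erase hj]
    rw [this, Pi.add_apply, Pi.single_eq_same, show w i + s * w i = w i * (1 + s) by ring,
      Real.log_mul (hw i).ne' hs.ne']
    ring
  rw [tylerPotential, tylerPotential, e, es, Real.log_mul hd.ne' hpos.ne'] at h
  have h1 : (Fintype.card κ : ℝ) * Real.log (1 + s) ≤
      Fintype.card ι * Real.log (1 + s * w i * lev X w i i) := by linarith
  have h2 := Real.log_le_sub_one_of_pos hpos
  have h3 := Real.one_sub_inv_le_log_of_pos hs
  have h4 : (Fintype.card κ : ℝ) * (1 - (1 + s)⁻¹) ≤ Fintype.card ι * (s * w i * lev X w i i) := by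
    calc (Fintype.card κ : ℝ) * (1 - (1 + s)⁻¹) ≤ Fintype.card κ * Real.log (1 + s) := by gcongr
      _ ≤ _ := h1
      _ ≤ _ := by gcongr; linarith
  calc (Fintype.card κ : ℝ) * s = Fintype.card κ * (1 - (1 + s)⁻¹) * (1 + s) := by
        field_simp; ring
    _ ≤ Fintype.card ι * (s * w i * lev X w i i) * (1 + s) := by gcongr
    _ = _ := by ring

/-- Off the upper face of the box the coordinate may be increased; let `s → 0⁺`. -/
lemma le_of_isMinOn_of_lt {w : ι → ℝ} (hX : (wgram X 1).det ≠ 0)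
    (hwK : w ∈ Set.Icc (fun _ : ι => (1 / 2 : ℝ)) (fun _ => 1))
    (hmin : IsMinOn (tylerPotential X) (Set.Icc (fun _ => 1 / 2) (fun _ => 1)) w)
    {i : ι} (hi : w i < 1) : (Fintype.card κ : ℝ) ≤ Fintype.card ι * (w i * lev X w i i) := by
  have hw : ∀ i, 0 < w i := fun i => lt_of_lt_of_le (by norm_num) (hwK.1 i)
  have ht : Tendsto (fun s : ℝ => (Fintype.card ι * (w i * lev X w i i)) * (1 + s)) (𝓝[>] 0)
      (𝓝 ((Fintype.card ι * (w i * lev X w i i)) * (1 + 0))) :=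
    (Continuous.tendsto (by fun_prop) 0).mono_left nhdsWithin_le_nhds
  rw [add_zero, mul_one] at ht
  refine ge_of_tendsto ht ?_
  have hs0 : 0 < (w i)⁻¹ - 1 := sub_pos.2 ((one_lt_inv₀ (hw i)).2 hi)
  filter_upwards [Ioo_mem_nhdsGT hs0] with s hs
  have h := mul_le_of_tylerPotential_le hw hX (i := i) (s := s) (by linarith [hs.1]) (hmin ?_)
  · exact le_of_mul_le_mul_right (by linarith) hs.1
  · have hb : s * w i ≤ 1 - w i := by
      have := mul_le_mul_of_nonneg_right hs.2.le (hw i).le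
      rwa [sub_mul, inv_mul_cancel₀ (hw i).ne', one_mul] at this
    have hc : 0 ≤ s * w i := mul_nonneg hs.1.le (hw i).le
    refine ⟨fun j => ?_, fun j => ?_⟩ <;> by_cases hj : j = i
    · subst hj; simpa using (hwK.1 j).trans (by simpa using hc)
    · simpa [hj] using hwK.1 j
    · subst hj; simp; linarith
    · simpa [hj] using hwK.2 j

/-- Off the lower face the coordinate may be decreased; let `s → 0⁺` in the variation `-s`. -/
lemma le_of_isMinOn_of_gt {w : ι → ℝ} (hX : (wgram X 1).det ≠ 0)
    (hwK : w ∈ Set.Icc (fun _ : ι => (1 / 2 : ℝ)) (fun _ => 1))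
    (hmin : IsMinOn (tylerPotential X) (Set.Icc (fun _ => 1 / 2) (fun _ => 1)) w)
    {i : ι} (hi : 1 / 2 < w i) : Fintype.card ι * (w i * lev X w i i) ≤ (Fintype.card κ : ℝ) := by
  have hw : ∀ i, 0 < w i := fun i => lt_of_lt_of_le (by norm_num) (hwK.1 i)
  have ht : Tendsto (fun s : ℝ => (Fintype.card ι * (w i * lev X w i i)) * (1 + -s)) (𝓝[>] 0)
      (𝓝 ((Fintype.card ι * (w i * lev X w i i)) * (1 + -0))) :=
    (Continuous.tendsto (by fun_prop) 0).mono_left nhdsWithin_le_nhds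
  rw [neg_zero, add_zero, mul_one] at ht
  refine le_of_tendsto ht ?_
  have hs0 : 0 < 1 - (2 * w i)⁻¹ := sub_pos.2 (inv_lt_one_of_one_lt₀ (by linarith))
  filter_upwards [Ioo_mem_nhdsGT hs0] with s hs
  have hs1 : s < 1 := hs.2.trans (by linarith [inv_pos.2 (mul_pos two_pos (hw i))])
  have h := mul_le_of_tylerPotential_le hw hX (i := i) (s := -s) (by linarith [hs.1]) (hmin ?_)
  · exact le_of_mul_le_mul_right (by linarith) hs.1
  · have hb : s * w i ≤ w i - 1 / 2 := by
      have := mul_le_mul_of_nonneg_right hs.2.le (hw i).le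
      rwa [sub_mul, mul_inv, mul_assoc, inv_mul_cancel₀ (hw i).ne', one_mul, mul_one,
        ← one_div] at this
    have hc : 0 ≤ s * w i := mul_nonneg hs.1.le (hw i).le
    refine ⟨fun j => ?_, fun j => ?_⟩ <;> by_cases hj : j = i
    · subst hj; simp only [Pi.add_apply, Pi.single_eq_same]; linarith
    · simpa [hj] using hwK.1 j
    · subst hj; simp only [Pi.add_apply, Pi.single_eq_same]; linarith [hwK.2 j]
    · simpa [hj] using hwK.2 j

/-- Stationary weights exist when the leverages are nearly constant and any two rows of the
projection matrix overlap. -/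
lemma exists_stationary_weights [Nonempty ι] (hX : (wgram X 1).det ≠ 0) {r η c : ℝ}
    (hr : r * Fintype.card ι = Fintype.card κ)
    (hh : ∀ i, |lev X 1 i i - r| ≤ η) (hc0 : 0 < c)
    (hc : ∀ i k, i ≠ k → c ≤ ∑ j, min (lev X 1 i j ^ 2) (lev X 1 k j ^ 2))
    (hη : 16 * η < c) :
    ∃ w : ι → ℝ, (∀ i, 0 < w i) ∧ ∀ i, w i * lev X w i i = r := by
  have hcard : (0 : ℝ) < Fintype.card ι := by exact_mod_cast Fintype.card_pos
  obtain ⟨w, hwK, hmin⟩ := isCompact_Icc.exists_isMinOn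
    (s := Set.Icc (fun _ : ι => (1 / 2 : ℝ)) (fun _ => 1))
    ⟨fun _ => 1, fun _ => by norm_num, le_rfl⟩ (continuousOn_tylerPotential hX)
  have hw : ∀ i, 0 < w i := fun i => lt_of_lt_of_le (by norm_num) (hwK.1 i)
  obtain ⟨i, hi⟩ := Finite.exists_max w
  obtain ⟨k, hk⟩ := Finite.exists_min w
  -- If the weights are not constant, the largest is off the lower face and the smallest off the
  -- upper face. The one-sided conditions there have exactly the signs the stability estimate needs,
  -- and `2η/c < 1/8`.
  have hratio : 7 / 8 * w i < w k := by
    by_cases hik : w k = w i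
    · rw [hik]; linarith [hw i]
    have hlt : w k < w i := lt_of_le_of_ne (hi k) hik
    have h1 := le_of_isMinOn_of_lt hX hwK hmin (i := k) (hlt.trans_le (hwK.2 i))
    have h2 := le_of_isMinOn_of_gt hX hwK hmin (i := i) ((hwK.1 k).trans_lt hlt)
    have := one_sub_div_mul_le (hw k) (fun j => ⟨hk j, hi j⟩) hX (i := i) (k := k) (r := r)
      (η := η) (c := c)
      (le_of_mul_le_mul_left (by linarith) hcard) (le_of_mul_le_mul_left (by linarith) hcard)
      (by linarith [(abs_le.1 (hh i)).1]) (by linarith [(abs_le.1 (hh k)).2])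
      (hc i k (by rintro rfl; exact hik rfl))
    have h3 : 1 - w k / w i < 1 / 8 := by
      by_contra! hcon
      nlinarith
    have h4 : 7 / 8 < w k / w i := by linarith
    rwa [lt_div_iff₀ (hw i)] at h4
  -- Rescaling the maximum to `15/16` places all weights in `(105/128, 15/16]`, inside the open box.
  -- The minimum is kept by scale invariance, so both one-sided conditions hold everywhere.
  have ht : 0 < 15 / 16 / w i := div_pos (by norm_num) (hw i)
  have hup : ∀ j, (15 / 16 / w i) * w j < 1 := fun j => by
    rw [div_mul_eq_mul_div, div_lt_one (hw i)]; nlinarith [hi j, hw i]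
  have hlow : ∀ j, 1 / 2 < (15 / 16 / w i) * w j := fun j => by
    rw [div_mul_eq_mul_div, lt_div_iff₀ (hw i)]; nlinarith [hk j, hw i]
  have hmin' : IsMinOn (tylerPotential X) (Set.Icc (fun _ => 1 / 2) (fun _ => 1))
      ((15 / 16 / w i) • w) := fun v hv => by
    have := hmin hv
    simp only [Set.mem_ofPred_eq] at this ⊢
    rwa [tylerPotential_smul ht hw hX]
  refine ⟨(15 / 16 / w i) • w, fun j => mul_pos ht (hw j), fun j => ?_⟩
  have hK : (15 / 16 / w i) • w ∈ Set.Icc (fun _ : ι => (1 / 2 : ℝ)) (fun _ => 1) :=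
    ⟨fun j => (hlow j).le, fun j => (hup j).le⟩
  have h1 := le_of_isMinOn_of_lt hX hK hmin' (i := j) (hup j)
  have h2 := le_of_isMinOn_of_gt hX hK hmin' (i := j) (hlow j)
  refine mul_left_cancel₀ hcard.ne' ?_
  linarith

end Existence

/-! ### Uniqueness, and the deterministic comparison with the sample covariance -/

section Uniqueness

set_option linter.unusedSectionVars false

variable {ι κ : Type*} [Fintype ι] [Fintype κ] [DecidableEq κ] [DecidableEq ι] {X : ι → κ → ℝ}

/-- The stability estimate at the indices of the largest and smallest weight, where stationarity
supplies both of its order conditions. -/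
lemma stationary_oscillation {r η c : ℝ} (hX : (wgram X 1).det ≠ 0)
    (hh : ∀ i, |lev X 1 i i - r| ≤ η) (hη : 0 ≤ η) (hc0 : 0 < c)
    (hc : ∀ i k, i ≠ k → c ≤ ∑ j, min (lev X 1 i j ^ 2) (lev X 1 k j ^ 2))
    {w : ι → ℝ} (hw : ∀ i, 0 < w i) (hs : ∀ i, w i * lev X w i i = r) (a b : ι) :
    (1 - 2 * η / c) * w a ≤ w b := by
  have : Nonempty ι := ⟨a⟩
  obtain ⟨i, hi⟩ := Finite.exists_max w
  obtain ⟨k, hk⟩ := Finite.exists_min w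
  have hpos : 0 ≤ 2 * η / c := by positivity
  have hmain : 1 - 2 * η / c ≤ w k / w i := by
    by_cases hik : i = k
    · rw [hik, div_self (hw k).ne']; linarith
    have := one_sub_div_mul_le (hw k) (fun j => ⟨hk j, hi j⟩) hX (i := i) (k := k) (r := r)
      (η := η) (c := c) (hs i).le (hs k).ge
      (by linarith [(abs_le.1 (hh i)).1]) (by linarith [(abs_le.1 (hh k)).2]) (hc i k hik)
    have := (le_div_iff₀ hc0).2 this
    linarith
  rw [le_div_iff₀ (hw i)] at hmain
  rcases le_total 0 (1 - 2 * η / c) with h | h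
  · exact (mul_le_mul_of_nonneg_left (hi a) h).trans (hmain.trans (hk b))
  · exact (mul_nonpos_of_nonpos_of_nonneg h (hw a).le).trans (hw b).le

/-- Since nearly constant weights almost amount to a scaling, rows of rescaled leverages stay close
to rows of `H` in `ℓ²`. The cross term of the expansion collapses to `lev X v i i` because `H`
carries unit weights. -/
lemma sum_sq_lev_sub_le {r η κ' T : ℝ} (hX : (wgram X 1).det ≠ 0)
    {i : ι} (hh : |lev X 1 i i - r| ≤ η) (hr : 0 ≤ r) (hr1 : r ≤ 1) (hκ0 : 0 ≤ κ') (hκ : κ' ≤ 1 / 2)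
    {v : ι → ℝ} (hv : ∀ i, 0 < v i) (hs : ∀ i, v i * lev X v i i = r)
    (hT : ∀ j, v j ≤ T) (hT' : ∀ j, (1 - κ') * T ≤ v j) :
    ∑ j, (T * lev X v i j - lev X 1 i j) ^ 2 ≤ 2 * κ' + η := by
  have h1 := wgram_posDef (w := 1) (fun _ => one_pos) hX
  have hA := wgram_posDef hv hX
  have hT0 : 0 < T := (hv i).trans_le (hT i)
  have e : ∑ j, (T * lev X v i j - lev X 1 i j) ^ 2 =
      T ^ 2 * (∑ j, lev X v i j ^ 2) - 2 * T * (∑ j, (1 : ι → ℝ) j * lev X 1 j i * lev X v j i) +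
        ∑ j, (1 : ι → ℝ) j * lev X 1 i j ^ 2 := by
    rw [Finset.mul_sum, Finset.mul_sum, ← Finset.sum_sub_distrib, ← Finset.sum_add_distrib]
    refine Finset.sum_congr rfl fun j _ => ?_
    rw [lev_comm 1 j i, lev_comm v j i, Pi.one_apply]; ring
  rw [sum_lev_mul_lev h1, sum_mul_lev_sq h1] at e
  have h2 : (1 - κ') * T * ∑ j, lev X v i j ^ 2 ≤ lev X v i i := by
    rw [← sum_mul_lev_sq hA, Finset.mul_sum]
    gcongr with j _
    exact hT' j
  have ha : r ≤ T * lev X v i i := by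
    rw [← hs i]
    have : 0 ≤ lev X v i i := by
      have := hs i
      by_contra! hneg
      nlinarith [hv i, mul_pos (hv i) (neg_pos.2 hneg)]
    exact mul_le_mul_of_nonneg_right (hT i) this
  set s := ∑ j, lev X v i j ^ 2
  set a := T * lev X v i i with ha_def
  have h3 : (1 - κ') * (T ^ 2 * s) ≤ a := by
    have := mul_le_mul_of_nonneg_left h2 hT0.le
    linarith
  have hs0 : 0 ≤ T ^ 2 * s := mul_nonneg (sq_nonneg _) (Finset.sum_nonneg fun _ _ => sq_nonneg _)
  -- `(1 + 2κ')(1 - κ') ≥ 1` exactly because `0 ≤ κ' ≤ 1/2`.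
  have h4 : T ^ 2 * s ≤ (1 + 2 * κ') * a :=
    calc T ^ 2 * s ≤ ((1 + 2 * κ') * (1 - κ')) * (T ^ 2 * s) :=
          le_mul_of_one_le_left hs0 (by nlinarith)
      _ = (1 + 2 * κ') * ((1 - κ') * (T ^ 2 * s)) := by ring
      _ ≤ _ := by gcongr
  have h5 := (abs_le.1 hh).2
  have : T ^ 2 * s - 2 * a ≤ -r + 2 * κ' * r := by nlinarith
  have h6 : 2 * κ' * r ≤ 2 * κ' := by nlinarith
  have h7 : 2 * T * lev X v i i = 2 * a := by rw [ha_def]; ring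
  rw [e, h7]
  linarith

/-- If two rows for the weights `v` had disjoint supports, each `min(Hᵢⱼ², Hₖⱼ²)` would be at most a
squared distance between old and new rows. The total would be at most `8η/c + 2η < c`, against the
overlap of the rows of `H`. -/
lemma exists_common_lev_ne_zero {r η c : ℝ} (hX : (wgram X 1).det ≠ 0)
    (hh : ∀ i, |lev X 1 i i - r| ≤ η) (hη : 0 ≤ η) (hc0 : 0 < c) (hc1 : c ≤ 1)
    (hc : ∀ i k, i ≠ k → c ≤ ∑ j, min (lev X 1 i j ^ 2) (lev X 1 k j ^ 2))
    (hr : 0 ≤ r) (hr1 : r ≤ 1) (hηc : 16 * η < c ^ 2)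
    {v : ι → ℝ} (hv : ∀ i, 0 < v i) (hs : ∀ i, v i * lev X v i i = r) {i k : ι} (hik : i ≠ k) :
    ∃ j, lev X v i j ≠ 0 ∧ lev X v k j ≠ 0 := by
  have : Nonempty ι := ⟨i⟩
  obtain ⟨l, hl⟩ := Finite.exists_max v
  have hosc := fun j => stationary_oscillation hX hh hη hc0 hc hv hs l j
  have hκ0 : 0 ≤ 2 * η / c := by positivity
  have hκ : 2 * η / c ≤ c / 8 := by rw [div_le_iff₀ hc0]; nlinarith
  have b1 := sum_sq_lev_sub_le hX (hh i) hr hr1 hκ0 (by linarith) hv hs hl hosc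
  have b2 := sum_sq_lev_sub_le hX (hh k) hr hr1 hκ0 (by linarith) hv hs hl hosc
  by_contra! hcon
  have : ∑ j, min (lev X 1 i j ^ 2) (lev X 1 k j ^ 2) ≤
      ∑ j, (v l * lev X v i j - lev X 1 i j) ^ 2 + ∑ j, (v l * lev X v k j - lev X 1 k j) ^ 2 := by
    rw [← Finset.sum_add_distrib]
    refine Finset.sum_le_sum fun j _ => ?_
    by_cases h : lev X v i j = 0
    · refine (min_le_left _ _).trans ?_
      rw [h, mul_zero, zero_sub, neg_sq]
      linarith [sq_nonneg (v l * lev X v k j - lev X 1 k j)]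
    · refine (min_le_right _ _).trans ?_
      rw [hcon j h, mul_zero, zero_sub, neg_sq]
      linarith [sq_nonneg (v l * lev X v i j - lev X 1 i j)]
  have := hc i k hik
  nlinarith

/-- At the indices `i`, `k` of extreme ratio `w/v`, stationarity makes the right sides of both
comparisons vanish. Hence all deficits vanish, and an index `j` seen by both rows has `wⱼ = M vⱼ = m
vⱼ`. -/
lemma stationary_weights_unique {r η c : ℝ} (hX : (wgram X 1).det ≠ 0)
    (hh : ∀ i, |lev X 1 i i - r| ≤ η) (hη : 0 ≤ η) (hc0 : 0 < c) (hc1 : c ≤ 1)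
    (hc : ∀ i k, i ≠ k → c ≤ ∑ j, min (lev X 1 i j ^ 2) (lev X 1 k j ^ 2))
    (hr : 0 ≤ r) (hr1 : r ≤ 1) (hηc : 16 * η < c ^ 2)
    {v w : ι → ℝ} (hv : ∀ i, 0 < v i) (hsv : ∀ i, v i * lev X v i i = r)
    (hw : ∀ i, 0 < w i) (hsw : ∀ i, w i * lev X w i i = r) :
    ∃ t : ℝ, w = t • v := by
  rcases isEmpty_or_nonempty ι with hι | hι
  · exact ⟨1, Subsingleton.elim _ _⟩
  obtain ⟨i, hi⟩ := Finite.exists_max fun j => w j / v j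
  obtain ⟨k, hk⟩ := Finite.exists_min fun j => w j / v j
  set M := w i / v i with hM
  set m := w k / v k with hm
  have hM0 : 0 < M := div_pos (hw i) (hv i)
  have hm0 : 0 < m := div_pos (hw k) (hv k)
  have hAv := wgram_posDef hv hX
  have hAw := wgram_posDef hw hX
  have hwM : ∀ j, w j ≤ M * v j := fun j => (div_le_iff₀ (hv j)).1 (hi j)
  have hwm : ∀ j, m * v j ≤ w j := fun j => (le_div_iff₀ (hv j)).1 (hk j)
  have hMm : M = m := by
    by_cases hik : i = k
    · rw [hM, hm, hik]
    obtain ⟨j, hj1, hj2⟩ :=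
      exists_common_lev_ne_zero hX hh hη hc0 hc1 hc hr hr1 hηc hv hsv hik
    have u1 := sum_upper_deficit_le hM0 hAv hw hAw i
    have u2 := sum_lower_deficit_le hm0 hAv hw hAw k
    have e1 : M * lev X w i i - lev X v i i = 0 := by
      have := hv i; have := hsw i; have := hsv i
      rw [hM]; field_simp; linarith
    have e2 : lev X v k k - m * lev X w k k = 0 := by
      have := hv k; have := hsw k; have := hsv k
      rw [hm]; field_simp; linarith
    rw [e1] at u1
    rw [e2] at u2
    have p1 : ∀ j ∈ Finset.univ, 0 ≤ (v j - w j / M) * lev X v i j ^ 2 := fun j _ =>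
      mul_nonneg (sub_nonneg.2 ((div_le_iff₀ hM0).2 (by linarith [hwM j]))) (sq_nonneg _)
    have p2 : ∀ j ∈ Finset.univ, 0 ≤ (v j - m * v j ^ 2 / w j) * lev X v k j ^ 2 := fun j _ =>
      mul_nonneg (sub_nonneg.2 ((div_le_iff₀ (hw j)).2 (by nlinarith [hwm j, hv j])))
        (sq_nonneg _)
    have z1 := (Finset.sum_eq_zero_iff_of_nonneg p1).1
      (le_antisymm u1 (Finset.sum_nonneg p1)) j (Finset.mem_univ j)
    have z2 := (Finset.sum_eq_zero_iff_of_nonneg p2).1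
      (le_antisymm u2 (Finset.sum_nonneg p2)) j (Finset.mem_univ j)
    have y1 := (mul_eq_zero.1 z1).resolve_right (pow_ne_zero 2 hj1)
    have y2 := (mul_eq_zero.1 z2).resolve_right (pow_ne_zero 2 hj2)
    have x1 : w j = M * v j := by field_simp at y1; linarith
    have x2 : w j = m * v j := by
      rw [sub_eq_zero, eq_div_iff (hw j).ne'] at y2
      exact mul_left_cancel₀ (hv j).ne' (by linarith)
    exact mul_right_cancel₀ (hv j).ne' (x1.symm.trans x2)
  exact ⟨M, funext fun j => le_antisymm (hwM j) (by rw [hMm]; exact hwm j)⟩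

/-- The matrix factors as `Xᵀ diag(c) X`. -/
lemma norm_wgram_le (c : ι → ℝ) {δ : ℝ} (hδ : 0 ≤ δ) (hc : ∀ i, |c i| ≤ δ) :
    ‖wgram X c‖ ≤ δ * ‖Matrix.of X‖ ^ 2 := by
  have e : wgram X c = (Matrix.of X)ᴴ * Matrix.diagonal c * Matrix.of X := by
    ext a b
    rw [Matrix.mul_apply]
    simp only [Matrix.mul_diagonal, wgram, Matrix.sum_apply, Matrix.smul_apply,
      Matrix.vecMulVec_apply, Matrix.conjTranspose_apply, Matrix.of_apply, star_trivial,
      smul_eq_mul]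
    exact Finset.sum_congr rfl fun j _ => by ring
  have hd : ‖Matrix.diagonal c‖ ≤ δ := by
    rw [Matrix.l2_opNorm_diagonal]
    exact (pi_norm_le_iff_of_nonneg hδ).2 hc
  rw [e]
  calc _ ≤ ‖(Matrix.of X)ᴴ * Matrix.diagonal c‖ * ‖Matrix.of X‖ := Matrix.l2_opNorm_mul _ _
    _ ≤ (‖(Matrix.of X)ᴴ‖ * ‖Matrix.diagonal c‖) * ‖Matrix.of X‖ := by
        gcongr; exact Matrix.l2_opNorm_mul _ _
    _ ≤ (‖Matrix.of X‖ * δ) * ‖Matrix.of X‖ := by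
        rw [Matrix.l2_opNorm_conjTranspose]; gcongr
    _ = _ := by ring

end Uniqueness

/-! ### Tyler's equation in terms of stationary weights -/

section Tyler

variable {n p : ℕ} {x : Fin n → EuclideanSpace ℝ (Fin p)}

lemma IsTylerEstimator.exists_weights (hn : 0 < n) (hp : 0 < p) (hx : ∀ i, (x i).ofLp ≠ 0)
    {S : Matrix (Fin p) (Fin p) ℝ} (hS : IsTylerEstimator x S) :
    ∃ w : Fin n → ℝ, (∀ i, 0 < w i) ∧
      (∀ i, w i * lev (fun i => (x i).ofLp) w i i = (p : ℝ) / n) ∧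
      S = wgram (fun i => (x i).ofLp) w := by
  have hr : (0 : ℝ) < (p : ℝ) / n := by positivity
  have ha : ∀ i, 0 < (x i).ofLp ⬝ᵥ (S⁻¹ *ᵥ (x i).ofLp) := fun i => by
    simpa using hS.posDef.inv.dotProduct_mulVec_pos (hx i)
  have e : S = wgram (fun i => (x i).ofLp)
      (fun i => (p : ℝ) / n * ((x i).ofLp ⬝ᵥ (S⁻¹ *ᵥ (x i).ofLp))⁻¹) := by
    conv_lhs => rw [hS.equation]
    rw [wgram, Finset.smul_sum]
    exact Finset.sum_congr rfl fun i _ => by rw [smul_smul]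
  refine ⟨_, fun i => mul_pos hr (inv_pos.2 (ha i)), fun i => ?_, e⟩
  rw [lev, ← e]
  have := (ha i).ne'
  field_simp

/-- Stationarity is invariant under scaling of the weights; the trace condition fixes the scale. -/
lemma isTylerEstimator_of_weights (hn : 0 < n) (hp : 0 < p)
    (hX : (wgram (fun i => (x i).ofLp) 1).det ≠ 0) {w : Fin n → ℝ} (hw : ∀ i, 0 < w i)
    (hs : ∀ i, w i * lev (fun i => (x i).ofLp) w i i = (p : ℝ) / n) :
    IsTylerEstimator x ((wgram (fun i => (x i).ofLp) w).trace⁻¹ •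
      wgram (fun i => (x i).ofLp) w) := by
  have hA := wgram_posDef hw hX
  have : Nonempty (Fin p) := ⟨⟨0, hp⟩⟩
  have ht := hA.trace_pos
  have hr : (0 : ℝ) < (p : ℝ) / n := by positivity
  refine ⟨hA.smul (inv_pos.2 ht), ?_, ?_⟩
  · rw [inv_smul_of_posDef (inv_pos.2 ht).ne' hA, inv_inv]
    generalize hT : (wgram (fun i => (x i).ofLp) w).trace = T at ht
    conv_lhs => rw [wgram]
    rw [Finset.smul_sum, Finset.smul_sum]
    refine Finset.sum_congr rfl fun i _ => ?_
    rw [smul_smul, smul_smul, Matrix.smul_mulVec, dotProduct_smul, smul_eq_mul]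
    change _ = ((p : ℝ) / n * (T *
      lev (fun i => (x i).ofLp) w i i)⁻¹) • _
    congr 1
    have h0 : lev (fun i => (x i).ofLp) w i i ≠ 0 := fun h => by
      have := hs i; rw [h, mul_zero] at this; exact hr.ne this
    rw [← hs i]
    field_simp
  · rw [Matrix.trace_smul, smul_eq_mul, inv_mul_cancel₀ ht.ne']

/-- Deterministic comparison of Tyler's estimator with the sample covariance. -/
theorem hasTylerEstimator_and_norm_sub_le (hn : 0 < n) (hp : 0 < p) (hpn : p ≤ n)
    {η η' c K : ℝ} (hX : (wgram (fun i => (x i).ofLp) 1).det ≠ 0)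
    (hh : ∀ i, |lev (fun i => (x i).ofLp) 1 i i - (p : ℝ) / n| ≤ η)
    (hη : 0 ≤ η) (hηr : η < (p : ℝ) / n) (hc0 : 0 < c) (hc1 : c ≤ 1)
    (hc : ∀ i k, i ≠ k → c ≤ ∑ j, min (lev (fun i => (x i).ofLp) 1 i j ^ 2)
      (lev (fun i => (x i).ofLp) 1 k j ^ 2))
    (hηc : 16 * η < c ^ 2)
    (htr : |(wgram (fun i => (x i).ofLp) 1).trace - n * p| ≤ η' * (n * p))
    (hη'0 : 0 ≤ η') (hη' : η' ≤ 1 / 4)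
    (hK : ‖Matrix.of fun i => (x i).ofLp‖ ^ 2 ≤ K * n) :
    HasTylerEstimator x ∧
      ‖(p : ℝ) • tylerEstimator x - sampleCovariance x‖ ≤ 2 * (2 * η / c + η') * K := by
  have hn' : (0 : ℝ) < n := by exact_mod_cast hn
  have hp' : (0 : ℝ) < p := by exact_mod_cast hp
  have hr : (0 : ℝ) < (p : ℝ) / n := by positivity
  have hr1 : (p : ℝ) / n ≤ 1 := (div_le_one hn').2 (by exact_mod_cast hpn)
  have : Nonempty (Fin n) := ⟨⟨0, hn⟩⟩
  have hne : Nonempty (Fin p) := ⟨⟨0, hp⟩⟩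
  -- A zero row would have leverage `0`, which `η < p / n` excludes.
  have hx : ∀ i, (x i).ofLp ≠ 0 := fun i h0 => by
    have := (abs_le.1 (hh i)).1
    have h1 : lev (fun i => (x i).ofLp) 1 i i = 0 := by simp [lev, h0]
    linarith
  obtain ⟨w, hw, hs⟩ := exists_stationary_weights hX (r := (p : ℝ) / n)
    (by simp; field_simp) hh hc0 hc (by nlinarith)
  have huniq : HasTylerEstimator x := by
    refine ⟨_, isTylerEstimator_of_weights hn hp hX hw hs, fun S hS => ?_⟩
    obtain ⟨v, hv, hsv, rfl⟩ := hS.exists_weights hn hp hx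
    obtain ⟨t, rfl⟩ := stationary_weights_unique hX hh hη hc0 hc1 hc hr.le hr1 hηc hw hs hv hsv
    have htr := hS.trace_eq_one
    rw [wgram_smul, Matrix.trace_smul, smul_eq_mul] at htr
    rw [wgram_smul]
    congr 1
    exact eq_inv_of_mul_eq_one_left htr
  refine ⟨huniq, ?_⟩
  have hT : IsTylerEstimator x (tylerEstimator x) := by
    rw [tylerEstimator, dif_pos huniq]; exact huniq.choose_spec.1
  obtain ⟨v, hv, hsv, hvS⟩ := hT.exists_weights hn hp hx
  have htr1 := hT.trace_eq_one
  rw [hvS, wgram_trace] at htr1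
  rw [wgram_trace] at htr
  simp only [Pi.one_apply, one_mul] at htr
  have hosc := stationary_oscillation hX hh hη hc0 hc hv hsv
  have hκ0 : 0 ≤ 2 * η / c := by positivity
  have hκ : 2 * η / c ≤ 1 / 4 := by rw [div_le_iff₀ hc0]; nlinarith
  set κ := 2 * η / c
  set τ := ∑ i, (x i).ofLp ⬝ᵥ (x i).ofLp with hτ
  have hsq : ∀ i, 0 ≤ (x i).ofLp ⬝ᵥ (x i).ofLp := fun i =>
    Finset.sum_nonneg fun _ _ => mul_self_nonneg _
  -- The weights agree up to the factor `1 - κ` and `∑ vᵢ ‖xᵢ‖² = 1`, so each `vⱼ` is close to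
  -- `1/τ`, while `τ` is close to `n p`.
  have hup : ∀ j, (1 - κ) * (v j * τ) ≤ 1 := fun j => by
    conv_rhs => rw [← htr1]
    rw [hτ, Finset.mul_sum, Finset.mul_sum]
    refine Finset.sum_le_sum fun i _ => ?_
    rw [← mul_assoc]
    exact mul_le_mul_of_nonneg_right (hosc j i) (hsq i)
  have hlow : ∀ j, 1 - κ ≤ v j * τ := fun j => by
    calc 1 - κ = (1 - κ) * ∑ i, v i * (x i).ofLp ⬝ᵥ (x i).ofLp := by rw [htr1, mul_one]
      _ ≤ _ := ?_
    rw [hτ, Finset.mul_sum, Finset.mul_sum]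
    refine Finset.sum_le_sum fun i _ => ?_
    rw [← mul_assoc]
    exact mul_le_mul_of_nonneg_right (hosc i j) (hsq i)
  have hnp : (0 : ℝ) < n * p := by positivity
  obtain ⟨ht1, ht2⟩ := abs_le.1 htr
  have hw' : ∀ j, |n * p * v j - 1| ≤ 2 * (κ + η') := fun j => by
    have a1 := hup j
    have a2 := hlow j
    have hvj := hv j
    set z := n * p * v j with hz
    have hz0 : 0 < z := by positivity
    have b1 : v j * τ ≤ (1 + η') * z := by rw [hz]; nlinarith
    have b2 : (1 - η') * z ≤ v j * τ := by rw [hz]; nlinarith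
    rw [abs_le]
    constructor
    · nlinarith
    · have c1 : (1 - κ) * ((1 - η') * z) ≤ 1 :=
        (mul_le_mul_of_nonneg_left b2 (by linarith)).trans a1
      have c2 : (1 - κ - η') * z ≤ 1 := by nlinarith [mul_nonneg hκ0 hη'0]
      nlinarith [mul_nonneg hκ0 hη'0]
  have e : (p : ℝ) • tylerEstimator x - sampleCovariance x =
      (1 / (n : ℝ)) • wgram (fun i => (x i).ofLp) (fun j => n * p * v j - 1) := by
    rw [hvS, sampleCovariance, wgram, wgram, Finset.smul_sum, Finset.smul_sum, Finset.smul_sum,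
      ← Finset.sum_sub_distrib]
    refine Finset.sum_congr rfl fun i _ => ?_
    rw [smul_smul, smul_smul, ← sub_smul]
    congr 1
    field_simp
  rw [e, norm_smul, Real.norm_of_nonneg (by positivity)]
  calc _ ≤ 1 / (n : ℝ) * (2 * (κ + η') * (K * n)) := by
        gcongr
        exact (norm_wgram_le _ (by positivity) hw').trans (by gcongr)
    _ = _ := by field_simp

end Tyler

/-! ### Standard Gaussian vectors: images, chi-square tails -/

section Gaussian

open scoped RealInnerProductSpace

variable {E F : Type*} [NormedAddCommGroup E] [InnerProductSpace ℝ E] [FiniteDimensional ℝ E]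
  [MeasurableSpace E] [BorelSpace E] [NormedAddCommGroup F] [InnerProductSpace ℝ F]
  [FiniteDimensional ℝ F] [MeasurableSpace F] [BorelSpace F]

/-- A linear co-isometry maps the standard Gaussian to the standard Gaussian. -/
lemma stdGaussian_map_of_coisometry (f : E →ₗ[ℝ] F) (g : F → E) (hfg : ∀ x t, ⟪f x, t⟫ = ⟪x, g t⟫)
    (hg : ∀ t, f (g t) = t) : (stdGaussian E).map f = stdGaussian F := by
  have hf : Continuous f := f.continuous_of_finiteDimensional
  have hn : ∀ t, ‖g t‖ = ‖t‖ := fun t => by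
    rw [← sq_eq_sq₀ (norm_nonneg _) (norm_nonneg _), ← real_inner_self_eq_norm_sq,
      ← real_inner_self_eq_norm_sq, ← hfg, hg]
  apply Measure.ext_of_charFun
  ext t
  rw [charFun_stdGaussian, charFun_apply, integral_map hf.aemeasurable (by fun_prop)]
  simp_rw [hfg, ← charFun_apply, charFun_stdGaussian, hn]

/-- A matrix with orthonormal rows maps the standard Gaussian to the standard Gaussian. -/
lemma stdGaussian_map_mulVec {m k : Type*} [Fintype m] [Fintype k] [DecidableEq m]
    (A : Matrix m k ℝ) (hA : A * Aᵀ = 1) :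
    (stdGaussian (EuclideanSpace ℝ k)).map (fun z => WithLp.toLp 2 (A *ᵥ z.ofLp)) =
      stdGaussian (EuclideanSpace ℝ m) := by
  classical
  refine stdGaussian_map_of_coisometry (Matrix.toLpLin 2 2 A)
    (fun t => WithLp.toLp 2 (Aᵀ *ᵥ t.ofLp)) (fun x t => ?_) fun t => ?_
  · simp only [EuclideanSpace.inner_eq_star_dotProduct, star_trivial, Matrix.toLpLin_apply]
    rw [Matrix.dotProduct_mulVec, Matrix.mulVec_transpose]
  · rw [Matrix.toLpLin_apply, Matrix.mulVec_mulVec, hA, Matrix.one_mulVec]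

lemma integral_exp_mul_sq_gaussianReal {l : ℝ} (hl : l < 1 / 2) :
    ∫ x, Real.exp (l * x ^ 2) ∂(gaussianReal 0 1) = (√(1 - 2 * l))⁻¹ := by
  rw [integral_gaussianReal_eq_integral_smul one_ne_zero]
  have h : ∀ x : ℝ, gaussianPDFReal 0 1 x • Real.exp (l * x ^ 2) =
      (√(2 * Real.pi))⁻¹ * Real.exp (-(1 / 2 - l) * x ^ 2) := fun x => by
    rw [gaussianPDFReal, smul_eq_mul, mul_assoc, ← Real.exp_add]
    simp only [NNReal.coe_one, mul_one, sub_zero]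
    congr 2; ring
  simp_rw [h]
  rw [integral_const_mul, integral_gaussian, ← Real.sqrt_inv, ← Real.sqrt_inv,
    ← Real.sqrt_mul (by positivity)]
  congr 1
  have : 1 / 2 - l ≠ 0 := by linarith
  have : 1 - 2 * l ≠ 0 := by linarith
  field_simp

lemma integral_exp_mul_norm_sq_stdGaussian {l : ℝ} (hl : l < 1 / 2) :
    ∫ z, Real.exp (l * ‖z‖ ^ 2) ∂(stdGaussian E) = ((√(1 - 2 * l))⁻¹) ^ Module.finrank ℝ E := by
  rw [stdGaussian, integral_map (Measurable.aemeasurable (by fun_prop))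
    (Measurable.aestronglyMeasurable (by fun_prop))]
  have h : ∀ x : Fin (Module.finrank ℝ E) → ℝ,
      Real.exp (l * ‖∑ i, x i • stdOrthonormalBasis ℝ E i‖ ^ 2) =
        ∏ i, Real.exp (l * x i ^ 2) := fun x => by
    rw [← Real.exp_sum, ← Finset.mul_sum]
    congr 2
    rw [← (stdOrthonormalBasis ℝ E).sum_sq_inner_right]
    refine Finset.sum_congr rfl fun i _ => ?_
    rw [inner_sum, Finset.sum_eq_single i]
    · rw [inner_smul_right]; simp
    · intro j _ hj
      rw [inner_smul_right, (stdOrthonormalBasis ℝ E).orthonormal.2 hj.symm, mul_zero]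
    · simp
  simp_rw [h]
  rw [integral_fintype_prod_eq_prod (f := fun _ x => Real.exp (l * x ^ 2))]
  simp [integral_exp_mul_sq_gaussianReal hl]

/-- A non-integrable function would have Bochner integral `0`, but the computed value is nonzero. -/
lemma integrable_exp_mul_norm_sq_stdGaussian {l : ℝ} (hl : l < 1 / 2) :
    Integrable (fun z => Real.exp (l * ‖z‖ ^ 2)) (stdGaussian E) := by
  by_contra h
  have h1 := integral_undef h
  rw [integral_exp_mul_norm_sq_stdGaussian hl] at h1
  exact pow_ne_zero _ (inv_ne_zero (Real.sqrt_pos.2 (by linarith)).ne') h1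

lemma stdGaussian_norm_sq_ge_le {l : ℝ} (hl : l < 1 / 2) (hl0 : 0 ≤ l) (a : ℝ) :
    (stdGaussian E).real {z | a ≤ ‖z‖ ^ 2} ≤
      Real.exp (-l * a) * ((√(1 - 2 * l))⁻¹) ^ Module.finrank ℝ E := by
  rw [← integral_exp_mul_norm_sq_stdGaussian hl]
  exact measure_ge_le_exp_mul_mgf a hl0 (integrable_exp_mul_norm_sq_stdGaussian hl)

lemma stdGaussian_norm_sq_le_le {l : ℝ} (hl0 : 0 ≤ l) (a : ℝ) :
    (stdGaussian E).real {z | ‖z‖ ^ 2 ≤ a} ≤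
      Real.exp (l * a) * ((√(1 + 2 * l))⁻¹) ^ Module.finrank ℝ E := by
  have h := measure_le_le_exp_mul_mgf (X := fun z : E => ‖z‖ ^ 2) (μ := stdGaussian E) a
    (neg_nonpos.2 hl0) (integrable_exp_mul_norm_sq_stdGaussian (by linarith))
  rw [mgf, integral_exp_mul_norm_sq_stdGaussian (by linarith)] at h
  simpa using h

lemma inv_sqrt_pow_eq_exp {s : ℝ} (hs : 0 < s) (d : ℕ) :
    ((√s)⁻¹) ^ d = Real.exp (-(d / 2 * Real.log s)) := by
  rw [Real.exp_neg, inv_pow, mul_comm, ← Real.rpow_def_of_pos hs, Real.sqrt_eq_rpow,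
    ← Real.rpow_natCast, ← Real.rpow_mul hs.le]
  congr 2; ring

/-- Chi-square concentration. -/
lemma stdGaussian_abs_norm_sq_sub_le {ε : ℝ} (hε : 0 < ε) (hε1 : ε ≤ 1) :
    (stdGaussian E).real {z | ε * Module.finrank ℝ E ≤ |‖z‖ ^ 2 - Module.finrank ℝ E|} ≤
      2 * Real.exp (-(ε ^ 2 / 16) * Module.finrank ℝ E) := by
  set d := Module.finrank ℝ E
  have hd : (0 : ℝ) ≤ d := Nat.cast_nonneg d
  have h1 : (stdGaussian E).real {z | (1 + ε) * d ≤ ‖z‖ ^ 2} ≤ Real.exp (-(ε ^ 2 / 16) * d) := by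
    -- This exponent is not optimal; it is small enough for `log x ≥ 1 - 1/x` to suffice.
    refine (stdGaussian_norm_sq_ge_le (l := ε / 8) (by linarith) (by linarith) _).trans ?_
    rw [inv_sqrt_pow_eq_exp (by linarith), ← Real.exp_add, Real.exp_le_exp]
    have hl := Real.one_sub_inv_le_log_of_pos (x := 1 - 2 * (ε / 8)) (by linarith)
    have hs : (1 - 2 * (ε / 8))⁻¹ ≤ 1 + ε / 4 + 2 * (ε / 4) ^ 2 := by
      rw [inv_le_iff_one_le_mul₀ (by linarith)]; nlinarith [pow_pos hε 2]
    have : -(ε / 4) - ε ^ 2 / 8 ≤ Real.log (1 - 2 * (ε / 8)) := by linarith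
    nlinarith
  have h2 : (stdGaussian E).real {z | ‖z‖ ^ 2 ≤ (1 - ε) * d} ≤ Real.exp (-(ε ^ 2 / 16) * d) := by
    refine (stdGaussian_norm_sq_le_le (l := ε / 4) (by linarith) _).trans ?_
    rw [inv_sqrt_pow_eq_exp (by linarith), ← Real.exp_add, Real.exp_le_exp]
    have : ε / 2 - ε ^ 2 / 4 ≤ Real.log (1 + 2 * (ε / 4)) := by
      have h := Real.one_sub_inv_le_log_of_pos (x := 1 + 2 * (ε / 4)) (by linarith)
      have hs : (1 + 2 * (ε / 4))⁻¹ ≤ 1 - ε / 2 + ε ^ 2 / 4 := by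
        rw [inv_le_iff_one_le_mul₀ (by linarith)]; nlinarith [pow_pos hε 3]
      linarith
    nlinarith
  calc _ ≤ (stdGaussian E).real ({z | (1 + ε) * d ≤ ‖z‖ ^ 2} ∪ {z | ‖z‖ ^ 2 ≤ (1 - ε) * d}) := by
        refine measureReal_mono fun z hz => ?_
        rcases le_abs.1 (show ε * d ≤ |‖z‖ ^ 2 - d| from hz) with h | h
        · left; simp only [Set.mem_ofPred_eq]; linarith
        · right; simp only [Set.mem_ofPred_eq]; linarith
    _ ≤ _ := (measureReal_union_le _ _).trans (by linarith)

lemma stdGaussian_norm_sq_ge_le_exp (a : ℝ) :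
    (stdGaussian E).real {z | a ≤ ‖z‖ ^ 2} ≤ Real.exp (-a / 4) * 2 ^ Module.finrank ℝ E := by
  refine (stdGaussian_norm_sq_ge_le (l := 1 / 4) (by norm_num) (by norm_num) a).trans ?_
  rw [show -(1 / 4) * a = -a / 4 by ring]
  gcongr
  rw [inv_le_iff_one_le_mul₀ (Real.sqrt_pos.2 (by norm_num))]
  have : (1 / 2 : ℝ) ≤ √(1 - 2 * (1 / 4)) := Real.le_sqrt_of_sq_le (by norm_num)
  linarith

/-- Small ball estimate. -/
lemma stdGaussian_norm_sq_le_le_pow {t : ℝ} (ht : 0 < t) :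
    (stdGaussian E).real {z | ‖z‖ ^ 2 ≤ t * Module.finrank ℝ E} ≤
      (√(Real.exp 1 * t)) ^ Module.finrank ℝ E := by
  set d := Module.finrank ℝ E
  -- With this exponent the first factor is `e^(d/2)` and the second at most `t^(d/2)`.
  refine (stdGaussian_norm_sq_le_le (l := 1 / (2 * t)) (by positivity) _).trans ?_
  have h1 : Real.exp (1 / (2 * t) * (t * d)) = (√(Real.exp 1)) ^ d := by
    rw [Real.sqrt_eq_rpow, ← Real.exp_mul, ← Real.exp_nat_mul]
    congr 1; field_simp
  have h2 : (√(1 + 2 * (1 / (2 * t))))⁻¹ ≤ √t := by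
    rw [← Real.sqrt_inv]
    apply Real.sqrt_le_sqrt
    rw [inv_le_iff_one_le_mul₀ (by positivity)]
    field_simp; linarith
  rw [h1, ← mul_pow, Real.sqrt_mul (Real.exp_pos 1).le]
  gcongr

/-- Most coordinates of a standard Gaussian vector are not small. -/
lemma stdGaussian_sum_min_le (n : ℕ) :
    (stdGaussian (EuclideanSpace ℝ (Fin n))).real
      {g | ∑ j, min (100000 * g j ^ 2 : ℝ) 1 ≤ 3 / 4 * (n : ℝ)} ≤ (1 / 2) ^ n := by
  have hmeas : Measurable fun x : ℝ => Real.exp (-(4 * min (100000 * x ^ 2) 1)) := by fun_prop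
  have hbd : ∀ x : ℝ, Real.exp (-(4 * min (100000 * x ^ 2) 1)) ≤ 1 := fun x => by
    rw [Real.exp_le_one_iff]
    have : 0 ≤ min (100000 * x ^ 2) 1 := le_min (by positivity) zero_le_one
    linarith
  have hint : Integrable (fun x : ℝ => Real.exp (-(4 * min (100000 * x ^ 2) 1)))
      (gaussianReal 0 1) :=
    Integrable.of_bound hmeas.aestronglyMeasurable 1 (ae_of_all _ fun x => by
      rw [Real.norm_of_nonneg (Real.exp_pos _).le]; exact hbd x)
  -- The small ball bound in dimension one: `√(e / 100000) ≤ 1/190`.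
  have hsmall : (gaussianReal 0 1).real {x : ℝ | x ^ 2 ≤ 1 / 100000} ≤ 1 / 190 := by
    have h := stdGaussian_norm_sq_le_le_pow (E := EuclideanSpace ℝ (Fin 1))
      (t := 1 / 100000) (by norm_num)
    rw [← map_pi_eq_stdGaussian, measureReal_def, Measure.map_apply (by fun_prop)
      (measurableSet_le (by fun_prop) (by fun_prop))] at h
    simp only [finrank_euclideanSpace, Fintype.card_fin, Nat.cast_one, mul_one, pow_one] at h
    have e : (WithLp.toLp 2 : (Fin 1 → ℝ) → _) ⁻¹' {z : EuclideanSpace ℝ (Fin 1) |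
        ‖z‖ ^ 2 ≤ 1 / 100000} = Function.eval 0 ⁻¹' {x : ℝ | x ^ 2 ≤ 1 / 100000} := by
      ext x
      simp [EuclideanSpace.real_norm_sq_eq]
    rw [e, (measurePreserving_eval (fun _ : Fin 1 => gaussianReal 0 1) 0).measure_preimage
      (measurableSet_le (by fun_prop) (by fun_prop)).nullMeasurableSet] at h
    refine h.trans (Real.sqrt_le_iff.2 ⟨by norm_num, ?_⟩)
    have := Real.exp_one_lt_d9
    linarith
  have h1 : ∫ x, Real.exp (-(4 * min (100000 * x ^ 2) 1)) ∂(gaussianReal 0 1) ≤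
      Real.exp (-4) + 1 / 190 := by
    have hs : MeasurableSet {x : ℝ | x ^ 2 ≤ 1 / 100000} :=
      measurableSet_le (by fun_prop) (by fun_prop)
    have hi : Integrable ({x : ℝ | x ^ 2 ≤ 1 / 100000}.indicator (fun _ => (1 : ℝ)))
        (gaussianReal 0 1) := (integrable_const 1).indicator hs
    calc _ ≤ ∫ x, (Real.exp (-4) + {x : ℝ | x ^ 2 ≤ 1 / 100000}.indicator (fun _ => 1) x)
          ∂(gaussianReal 0 1) := by
          refine integral_mono hint ((integrable_const _).add hi) fun x => ?_
          by_cases hx : x ∈ {x : ℝ | x ^ 2 ≤ 1 / 100000}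
          · rw [Set.indicator_of_mem hx]
            linarith [hbd x, Real.exp_pos (-4)]
          · rw [Set.indicator_of_notMem hx, add_zero, min_eq_right, mul_one]
            have : ¬ (x ^ 2 ≤ 1 / 100000) := hx
            linarith
      _ ≤ _ := by
          rw [integral_add (integrable_const _) hi, integral_indicator_const _ hs]
          simpa using hsmall
  have h2 : ∫ g, Real.exp (-(4 * ∑ j, min (100000 * g j ^ 2) 1))
      ∂(stdGaussian (EuclideanSpace ℝ (Fin n))) ≤ (Real.exp (-4) + 1 / 190) ^ n := by
    rw [← map_pi_eq_stdGaussian, integral_map (by fun_prop)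
      (Measurable.aestronglyMeasurable (by fun_prop))]
    have : ∀ x : Fin n → ℝ, Real.exp (-(4 * ∑ j, min (100000 * (WithLp.toLp 2 x) j ^ 2) 1)) =
        ∏ j, Real.exp (-(4 * min (100000 * x j ^ 2) 1)) := fun x => by
      rw [← Real.exp_sum, Finset.mul_sum, Finset.sum_neg_distrib]
    simp_rw [this]
    rw [integral_fintype_prod_eq_prod (f := fun _ x => Real.exp (-(4 * min (100000 * x ^ 2) 1)))]
    rw [Finset.prod_const, Finset.card_univ, Fintype.card_fin]
    exact pow_le_pow_left₀ (integral_nonneg fun x => (Real.exp_pos _).le) h1 n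
  -- Chernoff with parameter `-4`: the threshold contributes `e³` per coordinate, and `e³ (e⁻⁴ +
  -- 1/190) ≤ 1/2`.
  have h3 := measure_le_le_exp_mul_mgf (μ := stdGaussian (EuclideanSpace ℝ (Fin n)))
    (X := fun g => ∑ j, min (100000 * g j ^ 2) 1) (t := -4) (3 / 4 * (n : ℝ)) (by norm_num)
    (Integrable.of_bound (Measurable.aestronglyMeasurable (by fun_prop)) 1
      (ae_of_all _ fun g => by
        rw [Real.norm_of_nonneg (Real.exp_pos _).le, Real.exp_le_one_iff]
        have : 0 ≤ ∑ j, min (100000 * g j ^ 2) 1 :=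
          Finset.sum_nonneg fun j _ => le_min (by positivity) zero_le_one
        linarith))
  refine h3.trans ?_
  rw [mgf]
  simp_rw [neg_mul (4 : ℝ)]
  calc _ ≤ Real.exp (-(-(4 * (3 / 4 * (n : ℝ))))) * (Real.exp (-4) + 1 / 190) ^ n := by
        gcongr
        linarith
    _ = (Real.exp (-1) + Real.exp 3 / 190) ^ n := by
        rw [show -(-(4 * (3 / 4 * (n : ℝ)))) = n * 3 by ring, Real.exp_nat_mul, ← mul_pow, mul_add,
          ← Real.exp_add]
        norm_num
        ring
    _ ≤ (1 / 2) ^ n := by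
        gcongr
        have a := Real.exp_one_lt_d9
        have b := Real.exp_one_gt_d9
        have e3 : Real.exp 3 = Real.exp 1 ^ 3 := by rw [← Real.exp_nat_mul]; norm_num
        have e1 : Real.exp (-1) ≤ 0.37 := by
          rw [Real.exp_neg, inv_le_iff_one_le_mul₀ (Real.exp_pos 1)]; linarith
        have : Real.exp 1 ^ 3 ≤ 2.72 ^ 3 := by gcongr; linarith
        rw [e3]
        norm_num at this e1 ⊢
        linarith

end Gaussian

/-! ### Uniqueness of rotation invariant measures on a sphere -/

section Sphere

open scoped RealInnerProductSpace

variable {E : Type*} [NormedAddCommGroup E] [InnerProductSpace ℝ E] [FiniteDimensional ℝ E]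
  [MeasurableSpace E] [BorelSpace E]

lemma charFun_eq_of_rotation {μ : Measure E} {w w' : E}
    (h : ∃ R : E → E, Measurable R ∧ μ.map R = μ ∧ ∀ u, ⟪R u, w⟫ = ⟪u, w'⟫) (s : ℝ) :
    charFun μ (s • w) = charFun μ (s • w') := by
  obtain ⟨R, hR, hμ, hRw⟩ := h
  conv_lhs => rw [← hμ]
  rw [charFun_apply, charFun_apply, integral_map hR.aemeasurable
    (Measurable.aestronglyMeasurable (by fun_prop))]
  simp_rw [inner_smul_right, hRw]

/-- Two finite measures on the unit sphere of a subspace which are invariant under a transitive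
family of rotations are proportional. -/
lemma measure_univ_smul_eq_of_rotation_invariant (K : Submodule ℝ E) {μ ν : Measure E}
    [IsFiniteMeasure μ] [IsFiniteMeasure ν]
    (hμK : ∀ᵐ u ∂μ, u ∈ K ∧ ‖u‖ = 1) (hνK : ∀ᵐ u ∂ν, u ∈ K ∧ ‖u‖ = 1)
    (hμ : ∀ w ∈ K, ∀ w' ∈ K, ‖w‖ = 1 → ‖w'‖ = 1 →
      ∃ R : E → E, Measurable R ∧ μ.map R = μ ∧ ∀ u, ⟪R u, w⟫ = ⟪u, w'⟫)
    (hν : ∀ w ∈ K, ∀ w' ∈ K, ‖w‖ = 1 → ‖w'‖ = 1 →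
      ∃ R : E → E, Measurable R ∧ ν.map R = ν ∧ ∀ u, ⟪R u, w⟫ = ⟪u, w'⟫) :
    ν Set.univ • μ = μ Set.univ • ν := by
  by_cases hK : ∃ w₀ ∈ K, ‖w₀‖ = 1
  swap
  · have h0 : ∀ {ρ : Measure E}, (∀ᵐ u ∂ρ, u ∈ K ∧ ‖u‖ = 1) → ρ = 0 := fun {ρ} h => by
      rw [← ae_eq_bot, ← Filter.empty_mem_iff_bot]
      filter_upwards [h] with u hu
      exact hK ⟨u, hu⟩
    rw [h0 hμK, h0 hνK]
  obtain ⟨w₀, hw₀K, hw₀⟩ := hK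
  have hfin1 : IsFiniteMeasure (ν Set.univ • μ) := μ.smul_finite (measure_ne_top _ _)
  have hfin2 : IsFiniteMeasure (μ Set.univ • ν) := ν.smul_finite (measure_ne_top _ _)
  -- Only frequencies in `K` matter, since both measures live on `K`.
  have hproj : ∀ {ρ : Measure E}, (∀ᵐ u ∂ρ, u ∈ K ∧ ‖u‖ = 1) → ∀ t, charFun ρ t =
      charFun ρ (K.starProjection t) := fun {ρ} h t => by
    rw [charFun_apply, charFun_apply]
    refine integral_congr_ae ?_
    filter_upwards [h] with u hu
    rw [← Submodule.inner_starProjection_left_eq_right, Submodule.starProjection_eq_self_iff.2 hu.1]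
  -- By invariance each characteristic function is constant on the sphere of radius `|s|` in `K`.
  -- The double integral of `exp(i s ⟪u, v⟫)` against `μ` and `ν`, taken in the two orders, gives
  -- the two sides.
  have hkey : ∀ s : ℝ, ∀ w ∈ K, ‖w‖ = 1 →
      ν.real Set.univ * charFun μ (s • w) = μ.real Set.univ * charFun ν (s • w) := by
    intro s w hwK hw
    have e1 : ∫ u, charFun μ (s • u) ∂ν = ν.real Set.univ * charFun μ (s • w) := by
      rw [integral_congr_ae (g := fun _ => charFun μ (s • w))]
      · simp
      · filter_upwards [hνK] with u hu
        exact charFun_eq_of_rotation (hμ u hu.1 w hwK hu.2 hw) s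
    have e2 : ∫ v, charFun ν (s • v) ∂μ = μ.real Set.univ * charFun ν (s • w) := by
      rw [integral_congr_ae (g := fun _ => charFun ν (s • w))]
      · simp
      · filter_upwards [hμK] with u hu
        exact charFun_eq_of_rotation (hν u hu.1 w hwK hu.2 hw) s
    rw [← e1, ← e2]
    simp_rw [charFun_apply]
    rw [integral_integral_swap]
    · simp_rw [inner_smul_right, real_inner_comm]
    · refine Integrable.of_bound (Measurable.aestronglyMeasurable ?_) 1 (ae_of_all _ fun x => ?_)
      · simp only [Function.uncurry_def]; fun_prop
      · rw [Function.uncurry_def, Complex.norm_exp_ofReal_mul_I]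
  apply Measure.ext_of_charFun
  ext t
  rw [charFun_apply, charFun_apply, integral_smul_measure, integral_smul_measure, ← charFun_apply,
    ← charFun_apply, hproj hμK, hproj hνK]
  obtain ⟨s, w, hwK, hw, hsw⟩ : ∃ (s : ℝ) (w : E), w ∈ K ∧ ‖w‖ = 1 ∧
      K.starProjection t = s • w := by
    by_cases h0 : K.starProjection t = 0
    · exact ⟨0, w₀, hw₀K, hw₀, by simp [h0]⟩
    · exact ⟨‖K.starProjection t‖, ‖K.starProjection t‖⁻¹ • K.starProjection t,
        K.smul_mem _ (Submodule.starProjection_apply_mem _ _), norm_smul_inv_norm h0,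
        by rw [smul_inv_smul₀ (norm_ne_zero_iff.2 h0)]⟩
  rw [hsw]
  exact hkey s w hwK hw

end Sphere

/-! ### Hat matrices, reflections, Gaussian matrices -/

section Hat

set_option linter.unusedSectionVars false

variable {ι κ : Type*} [Fintype ι] [Fintype κ] [DecidableEq κ] [DecidableEq ι]

/-- The projection matrix `X (XᵀX)⁻¹ Xᵀ`. -/
noncomputable def hatMatrix (X : Matrix ι κ ℝ) : Matrix ι ι ℝ := X * (Xᵀ * X)⁻¹ * Xᵀ

lemma wgram_one (X : ι → κ → ℝ) : wgram X 1 = (Matrix.of X)ᵀ * Matrix.of X := by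
  ext a b
  simp [wgram, Matrix.sum_apply, Matrix.vecMulVec_apply, Matrix.mul_apply]

lemma lev_one_eq_hatMatrix (X : ι → κ → ℝ) (i j : ι) :
    lev X 1 i j = hatMatrix (Matrix.of X) i j := by
  rw [lev, wgram_one, hatMatrix, Matrix.mul_assoc, Matrix.mul_apply]
  rfl

lemma hatMatrix_orthogonal_mul {O : Matrix ι ι ℝ} (hO : Oᵀ * O = 1) (X : Matrix ι κ ℝ) :
    hatMatrix (O * X) = O * hatMatrix X * Oᵀ := by
  have : (O * X)ᵀ * (O * X) = Xᵀ * X := by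
    rw [Matrix.transpose_mul, Matrix.mul_assoc, ← Matrix.mul_assoc Oᵀ, hO, Matrix.one_mul]
  rw [hatMatrix, this, Matrix.transpose_mul, hatMatrix]
  simp only [Matrix.mul_assoc]

lemma hatMatrix_mul_self {X : Matrix ι κ ℝ} (h : (Xᵀ * X).det ≠ 0) :
    hatMatrix X * hatMatrix X = hatMatrix X := by
  have h1 : (Xᵀ * X) * (Xᵀ * X)⁻¹ = 1 := Matrix.mul_nonsing_inv _ (isUnit_iff_ne_zero.2 h)
  calc hatMatrix X * hatMatrix X = X * (Xᵀ * X)⁻¹ * ((Xᵀ * X) * (Xᵀ * X)⁻¹) * Xᵀ := by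
        simp only [hatMatrix, Matrix.mul_assoc]
    _ = _ := by rw [h1, Matrix.mul_one, hatMatrix]

lemma hatMatrix_transpose (X : Matrix ι κ ℝ) : (hatMatrix X)ᵀ = hatMatrix X := by
  rw [hatMatrix, Matrix.transpose_mul, Matrix.transpose_mul, Matrix.transpose_nonsing_inv,
    Matrix.transpose_mul, Matrix.transpose_transpose, Matrix.mul_assoc]

open scoped MatrixOrder in
/-- The projection matrix factors through a matrix with orthonormal rows. -/
lemma exists_hatMatrix_eq {X : Matrix ι κ ℝ} (h : (Xᵀ * X).det ≠ 0) :
    ∃ L : Matrix κ ι ℝ, L * Lᵀ = 1 ∧ hatMatrix X = Lᵀ * L := by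
  have hps : (Xᵀ * X).PosSemidef := by
    simpa using Matrix.posSemidef_conjTranspose_mul_self X
  -- With `XᵀX = CᵀC`, the whitened matrix `L = (Cᵀ)⁻¹Xᵀ` has orthonormal rows.
  obtain ⟨C, hC⟩ := CStarAlgebra.nonneg_iff_eq_star_mul_self.1 hps.nonneg
  rw [Matrix.star_eq_conjTranspose, Matrix.conjTranspose_eq_transpose_of_trivial] at hC
  have hCd : IsUnit C.det := isUnit_iff_ne_zero.2 fun h0 => h (by rw [hC, Matrix.det_mul, h0, mul_zero])
  have hCd' : IsUnit Cᵀ.det := by rwa [Matrix.det_transpose]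
  refine ⟨Cᵀ⁻¹ * Xᵀ, ?_, ?_⟩
  · rw [Matrix.transpose_mul, Matrix.transpose_transpose, Matrix.transpose_nonsing_inv,
      Matrix.transpose_transpose, Matrix.mul_assoc, ← Matrix.mul_assoc Xᵀ, hC,
      Matrix.mul_assoc, Matrix.mul_nonsing_inv _ hCd, Matrix.mul_one,
      Matrix.nonsing_inv_mul _ hCd']
  · rw [Matrix.transpose_mul, Matrix.transpose_transpose, Matrix.transpose_nonsing_inv,
      Matrix.transpose_transpose, hatMatrix, hC, Matrix.mul_inv_rev]
    simp only [Matrix.mul_assoc]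

/-- The reflection matrix in the hyperplane orthogonal to `d`. -/
noncomputable def householder (d : ι → ℝ) : Matrix ι ι ℝ :=
  1 - (2 / (d ⬝ᵥ d)) • Matrix.vecMulVec d d

lemma householder_transpose (d : ι → ℝ) : (householder d)ᵀ = householder d := by
  simp [householder, Matrix.transpose_vecMulVec]

lemma householder_mulVec (d u : ι → ℝ) :
    householder d *ᵥ u = u - (2 / (d ⬝ᵥ d) * (d ⬝ᵥ u)) • d := by
  rw [householder, Matrix.sub_mulVec, Matrix.one_mulVec, Matrix.smul_mulVec,
    Matrix.vecMulVec_mulVec, mul_smul]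
  simp

lemma householder_mul_self (d : ι → ℝ) : householder d * householder d = 1 := by
  refine Matrix.ext_of_mulVec_single fun i => ?_
  rw [← Matrix.mulVec_mulVec, householder_mulVec, householder_mulVec, Matrix.one_mulVec]
  -- For `d = 0`, division by zero makes the reflection the identity, so no nonvanishing hypothesis
  -- is needed.
  by_cases h : d ⬝ᵥ d = 0
  · simp [h]
  rw [dotProduct_sub, dotProduct_smul, smul_eq_mul, sub_sub, ← add_smul]
  convert sub_zero _
  convert zero_smul ℝ d
  field_simp
  ring

lemma householder_mulVec_eq_self {d u : ι → ℝ} (h : d ⬝ᵥ u = 0) : householder d *ᵥ u = u := by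
  simp [householder_mulVec, h]

lemma householder_sub_mulVec {u v : ι → ℝ} (h : u ⬝ᵥ u = v ⬝ᵥ v) :
    householder (u - v) *ᵥ u = v := by
  rw [householder_mulVec]
  by_cases h0 : u - v = 0
  · simp [sub_eq_zero.1 h0]
  have h1 : (u - v) ⬝ᵥ (u - v) ≠ 0 := fun h => h0 (dotProduct_self_eq_zero.1 h)
  have h2 : (u - v) ⬝ᵥ (u - v) = 2 * ((u - v) ⬝ᵥ u) := by
    simp only [sub_dotProduct, dotProduct_sub, dotProduct_comm v u]; linarith
  have : 2 / ((u - v) ⬝ᵥ (u - v)) * ((u - v) ⬝ᵥ u) = 1 := by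
    rw [div_mul_eq_mul_div, ← h2, div_self h1]
  rw [this, one_smul]; abel

end Hat

/-! ### Invariance and measurability for Gaussian matrices -/

section GaussianMatrix

variable {n p : ℕ}

/-- The matrix with the coordinates of a vector indexed by pairs. -/
def toMat (h : EuclideanSpace ℝ (Fin n × Fin p)) : Matrix (Fin n) (Fin p) ℝ :=
  Matrix.of fun i a => h (i, a)

lemma continuous_toMat : Continuous (toMat : EuclideanSpace ℝ (Fin n × Fin p) → _) := by
  refine continuous_matrix fun i a => ?_
  simp only [toMat, Matrix.of_apply]
  fun_prop

open scoped Kronecker in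
/-- Multiplication of the rows by an orthogonal matrix preserves the Gaussian matrix law. -/
lemma exists_measurePreserving_toMat {O : Matrix (Fin n) (Fin n) ℝ} (hO : O * Oᵀ = 1) :
    ∃ φ : EuclideanSpace ℝ (Fin n × Fin p) → EuclideanSpace ℝ (Fin n × Fin p),
      MeasurePreserving φ (stdGaussian _) (stdGaussian _) ∧ ∀ h, toMat (φ h) = O * toMat h := by
  refine ⟨_, ⟨?_, stdGaussian_map_mulVec (O ⊗ₖ (1 : Matrix (Fin p) (Fin p) ℝ)) ?_⟩,
    fun h => ?_⟩
  · fun_prop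
  · rw [← Matrix.kroneckerMap_transpose, Matrix.transpose_one, ← Matrix.mul_kronecker_mul, hO,
      Matrix.mul_one, Matrix.one_kronecker_one]
  · ext i a
    simp only [toMat, Matrix.of_apply, Matrix.mulVec, dotProduct, Matrix.kronecker_apply,
      Matrix.mul_apply, Fintype.sum_prod_type]
    refine Finset.sum_congr rfl fun j _ => ?_
    rw [Finset.sum_eq_single a]
    · simp
    · intro b _ hb; simp [Matrix.one_apply_ne hb.symm]
    · simp

/-- A Gaussian matrix applied to a unit vector is a standard Gaussian vector. -/
lemma stdGaussian_map_toMat_mulVec {z : Fin p → ℝ} (hz : z ⬝ᵥ z = 1) :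
    (stdGaussian (EuclideanSpace ℝ (Fin n × Fin p))).map
      (fun h => WithLp.toLp 2 (toMat h *ᵥ z)) = stdGaussian (EuclideanSpace ℝ (Fin n)) := by
  have h := stdGaussian_map_mulVec
    (Matrix.of fun (i : Fin n) (q : Fin n × Fin p) => if i = q.1 then z q.2 else 0) ?_
  · convert h using 3 with h
    ext i
    simp [Matrix.mulVec, dotProduct, toMat, Fintype.sum_prod_type, mul_comm]
  · ext i j
    simp only [Matrix.mul_apply, Fintype.sum_prod_type, Matrix.transpose_apply, Matrix.of_apply,
      Matrix.one_apply]
    by_cases hij : i = j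
    · subst hij
      rw [if_pos rfl, ← hz, dotProduct]
      simp
    · rw [if_neg hij]
      refine Finset.sum_eq_zero fun k _ => Finset.sum_eq_zero fun a _ => ?_
      by_cases hk : i = k
      · subst hk; simp [Ne.symm hij]
      · simp [hk]

lemma measurable_hatMatrix_apply (i j : Fin n) :
    Measurable fun h : EuclideanSpace ℝ (Fin n × Fin p) => hatMatrix (toMat h) i j := by
  have hent : ∀ i a, Measurable fun h : EuclideanSpace ℝ (Fin n × Fin p) => toMat h i a :=
    fun i a => by simp only [toMat, Matrix.of_apply]; fun_prop
  have hinv : ∀ a b, Measurable fun h : EuclideanSpace ℝ (Fin n × Fin p) =>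
      ((toMat h)ᵀ * toMat h)⁻¹ a b := fun a b => by
    simp only [Matrix.inv_def, Matrix.smul_apply, smul_eq_mul, Ring.inverse_eq_inv']
    refine Measurable.mul (Measurable.inv ?_) ?_
    · exact (Continuous.matrix_det
        (continuous_toMat.matrix_transpose.matrix_mul continuous_toMat)).measurable
    · exact ((Continuous.matrix_adjugate
        (continuous_toMat.matrix_transpose.matrix_mul continuous_toMat)).matrix_elem a b).measurable
  simp only [hatMatrix, Matrix.mul_apply, Matrix.transpose_apply]
  refine Finset.measurable_sum _ fun a _ => (Finset.measurable_sum _ fun b _ => ?_).mul (hent j a)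
  exact (hent i b).mul (hinv b a)

end GaussianMatrix

/-! ### Volumetric bounds for the extreme singular values -/

section Volumetric

/-- If every `t ∈ A` has a ball of radius `r` of bad points in the ball of radius `R`, and every
point is bad with probability at most `q`, then `A` has probability at most `q (R / r) ^ d`. -/
lemma pow_mul_measure_le_of_forall_ball {T E : Type*} [MeasurableSpace T] (m : Measure T)
    [IsProbabilityMeasure m] [NormedAddCommGroup E] [InnerProductSpace ℝ E] [FiniteDimensional ℝ E]
    [MeasurableSpace E] [BorelSpace E] {A : Set T} {D : Set (T × E)} (hA : MeasurableSet A)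
    (hD : MeasurableSet D) {r R q : ℝ} (hr : 0 < r) (hR : 0 < R) (hq : 0 ≤ q)
    (hball : ∀ t ∈ A, ∃ z₀, ∀ z ∈ Metric.ball z₀ r, (t, z) ∈ D)
    (hDR : ∀ t z, (t, z) ∈ D → z ∈ Metric.ball (0 : E) R)
    (hDq : ∀ z, m.real {t | (t, z) ∈ D} ≤ q) :
    r ^ Module.finrank ℝ E * m.real A ≤ q * R ^ Module.finrank ℝ E := by
  set d := Module.finrank ℝ E
  set V := (volume : Measure E) (Metric.ball 0 1) with hV
  have hV0 : V ≠ 0 := (Metric.measure_ball_pos volume 0 one_pos).ne'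
  have hVt : V ≠ ⊤ := measure_ball_lt_top.ne
  -- Fubini for `D`: each section over `t ∈ A` contains a ball of radius `r`, while each section
  -- over `z` has probability at most `q` and is empty outside the ball of radius `R`.
  have h1 : ENNReal.ofReal (r ^ d) * V * m A ≤ (m.prod volume) D := by
    rw [Measure.prod_apply hD, ← setLIntegral_const]
    refine (setLIntegral_mono' hA fun t ht => ?_).trans (setLIntegral_le_lintegral _ _)
    obtain ⟨z₀, hz₀⟩ := hball t ht
    rw [← Measure.addHaar_ball_of_pos _ z₀ hr]
    exact measure_mono fun z hz => hz₀ z hz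
  have h2 : (m.prod volume) D ≤ ENNReal.ofReal q * (ENNReal.ofReal (R ^ d) * V) := by
    rw [Measure.prod_apply_symm hD, ← Measure.addHaar_ball_of_pos _ (0 : E) hR, ← setLIntegral_const,
      ← lintegral_indicator Metric.isOpen_ball.measurableSet]
    refine lintegral_mono fun z => ?_
    by_cases hz : z ∈ Metric.ball (0 : E) R
    · rw [Set.indicator_of_mem hz]
      rw [← ofReal_measureReal]
      exact ENNReal.ofReal_le_ofReal (hDq z)
    · have : (fun t => (t, z)) ⁻¹' D = ∅ := Set.eq_empty_of_forall_notMem fun t ht => hz (hDR t z ht)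
      simp [this]
  have h3 := h1.trans h2
  rw [mul_right_comm, ← mul_assoc, ENNReal.mul_le_mul_iff_left hV0 hVt,
    ← ofReal_measureReal (μ := m), ← ENNReal.ofReal_mul (by positivity),
    ← ENNReal.ofReal_mul hq] at h3
  exact (ENNReal.ofReal_le_ofReal_iff (by positivity)).1 h3

variable {n p : ℕ}

lemma norm_toLp_mulVec_le (X : Matrix (Fin n) (Fin p) ℝ) (z : EuclideanSpace ℝ (Fin p)) :
    ‖(WithLp.toLp 2 (X *ᵥ z.ofLp) : EuclideanSpace ℝ (Fin n))‖ ≤ ‖X‖ * ‖z‖ :=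
  Matrix.l2_opNorm_mulVec X z

lemma continuous_toMat_mulVec : Continuous
    fun q : EuclideanSpace ℝ (Fin n × Fin p) × EuclideanSpace ℝ (Fin p) =>
      (WithLp.toLp 2 (toMat q.1 *ᵥ q.2.ofLp) : EuclideanSpace ℝ (Fin n)) := by
  refine (PiLp.continuous_toLp 2 _).comp (Continuous.matrix_mulVec ?_ ?_)
  · exact continuous_toMat.comp continuous_fst
  · exact (PiLp.continuous_ofLp 2 _).comp continuous_snd

lemma stdGaussian_toMat_mulVec_eq {z : EuclideanSpace ℝ (Fin p)} (hz : z ≠ 0) {S : Set ℝ}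
    (hS : MeasurableSet S) :
    (stdGaussian (EuclideanSpace ℝ (Fin n × Fin p))).real
      {h | ‖(WithLp.toLp 2 (toMat h *ᵥ z.ofLp) : EuclideanSpace ℝ (Fin n))‖ / ‖z‖ ∈ S} =
    (stdGaussian (EuclideanSpace ℝ (Fin n))).real {g | ‖g‖ ∈ S} := by
  have hz' : 0 < ‖z‖ := norm_pos_iff.2 hz
  have hu : (‖z‖⁻¹ • z).ofLp ⬝ᵥ (‖z‖⁻¹ • z).ofLp = 1 := by
    have h2 : ‖(‖z‖⁻¹ • z)‖ ^ 2 = 1 := by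
      rw [norm_smul, norm_inv, norm_norm, inv_mul_cancel₀ hz'.ne', one_pow]
    rw [EuclideanSpace.real_norm_sq_eq] at h2
    rw [dotProduct, ← h2]
    exact Finset.sum_congr rfl fun i _ => (sq _).symm
  rw [← stdGaussian_map_toMat_mulVec (n := n) hu, measureReal_def, measureReal_def,
    Measure.map_apply]
  · congr 2
    ext h
    simp only [Set.mem_ofPred_eq, Set.mem_preimage, WithLp.ofLp_smul, Matrix.mulVec_smul,
      WithLp.toLp_smul, norm_smul, norm_inv, norm_norm]
    rw [div_eq_inv_mul]
  · exact (continuous_toMat_mulVec.comp (Continuous.prodMk_left _)).measurable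
  · exact hS.preimage measurable_norm

lemma exists_lt_norm_mulVec (X : Matrix (Fin n) (Fin p) ℝ) {r : ℝ} (hr : r < ‖X‖) :
    ∃ z : EuclideanSpace ℝ (Fin p), ‖z‖ < 1 ∧
      r < ‖(WithLp.toLp 2 (X *ᵥ z.ofLp) : EuclideanSpace ℝ (Fin n))‖ := by
  rw [Matrix.l2_opNorm_def] at hr
  exact ContinuousLinearMap.exists_lt_apply_of_lt_opNorm _ hr

/-- The map `z ↦ X z` is Lipschitz with constant `‖X‖`. -/
lemma norm_toLp_mulVec_sub_le (X : Matrix (Fin n) (Fin p) ℝ) (z v : EuclideanSpace ℝ (Fin p)) :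
    ‖(WithLp.toLp 2 (X *ᵥ z.ofLp) : EuclideanSpace ℝ (Fin n)) - WithLp.toLp 2 (X *ᵥ v.ofLp)‖ ≤
      ‖X‖ * ‖z - v‖ := by
  have := norm_toLp_mulVec_le X (z - v)
  rwa [WithLp.ofLp_sub, Matrix.mulVec_sub, WithLp.toLp_sub] at this

/-- The operator norm of a Gaussian matrix is `O(√n)` with exponentially small failure. -/
lemma stdGaussian_norm_toMat_gt_le (hpn : p ≤ n) (hn : 0 < n) :
    (stdGaussian (EuclideanSpace ℝ (Fin n × Fin p))).real {h | 256 * (n : ℝ) < ‖toMat h‖ ^ 2} ≤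
      Real.exp (-n) := by
  have hn' : (0 : ℝ) < n := by exact_mod_cast hn
  set s := 16 * √n with hs
  have hs2 : s ^ 2 = 256 * n := by rw [hs, mul_pow, Real.sq_sqrt hn'.le]; norm_num
  have hs0 : 0 < s := by positivity
  have key := pow_mul_measure_le_of_forall_ball (E := EuclideanSpace ℝ (Fin p))
    (stdGaussian (EuclideanSpace ℝ (Fin n × Fin p)))
    (A := {h | 256 * (n : ℝ) < ‖toMat h‖ ^ 2})
    (D := {q | ‖q.2‖ < 1} ∩ {q |
      s / 4 ≤ ‖(WithLp.toLp 2 (toMat q.1 *ᵥ q.2.ofLp) : EuclideanSpace ℝ (Fin n))‖})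
    (measurableSet_lt measurable_const ((continuous_toMat.norm.pow 2).measurable))
    ((measurableSet_lt measurable_snd.norm measurable_const).inter
      (measurableSet_le measurable_const continuous_toMat_mulVec.norm.measurable))
    (r := 1 / 4) (R := 1) (q := Real.exp (-(4 * n)) * 2 ^ n) (by norm_num) one_pos (by positivity)
    ?_ ?_ ?_
  · rw [finrank_euclideanSpace, Fintype.card_fin, one_pow, mul_one] at key
    set P := (stdGaussian (EuclideanSpace ℝ (Fin n × Fin p))).real {h | 256 * (n : ℝ) < ‖toMat h‖ ^ 2}
    have h4 : (1 / 4 : ℝ) ^ n ≤ (1 / 4) ^ p := pow_le_pow_of_le_one (by norm_num) (by norm_num) hpn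
    have h5 : (1 / 4 : ℝ) ^ n * P ≤ Real.exp (-(4 * n)) * 2 ^ n :=
      (mul_le_mul_of_nonneg_right h4 measureReal_nonneg).trans key
    -- The volume ratio costs `4ⁿ`, which the tail `e^(-4n) 2ⁿ` absorbs since `8 e⁻³ ≤ 1`.
    have h6 : P ≤ 4 ^ n * (Real.exp (-(4 * n)) * 2 ^ n) := by
      calc P = 4 ^ n * ((1 / 4 : ℝ) ^ n * P) := by
            rw [← mul_assoc, ← mul_pow]; norm_num
        _ ≤ _ := by gcongr
    refine h6.trans ?_
    have e1 : Real.exp (-(4 * n)) = Real.exp (-n) * (Real.exp (-3)) ^ n := by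
      rw [← Real.exp_nat_mul, ← Real.exp_add]; congr 1; ring
    rw [e1]
    calc (4 : ℝ) ^ n * (Real.exp (-n) * (Real.exp (-3)) ^ n * 2 ^ n)
        = Real.exp (-n) * (8 * Real.exp (-3)) ^ n := by
          rw [mul_pow, show (8 : ℝ) = 4 * 2 by norm_num, mul_pow]; ring
      _ ≤ Real.exp (-n) * 1 := by
          gcongr
          refine pow_le_one₀ (by positivity) ?_
          rw [Real.exp_neg, ← div_eq_mul_inv, div_le_one (Real.exp_pos 3)]
          have e3 : Real.exp 3 = Real.exp 1 ^ 3 := by rw [← Real.exp_nat_mul]; norm_num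
          have : (2 : ℝ) ^ 3 ≤ Real.exp 1 ^ 3 := by
            gcongr; linarith [Real.exp_one_gt_d9]
          rw [e3]; linarith
      _ = _ := mul_one _
  · intro h hh
    have hh' : s < ‖toMat h‖ := by
      refine lt_of_pow_lt_pow_left₀ 2 (norm_nonneg _) ?_
      rw [hs2]; exact hh
    have hX : 0 < ‖toMat h‖ := hs0.trans hh'
    obtain ⟨x, hx1, hx2⟩ := exists_lt_norm_mulVec (toMat h) (r := 2 / 3 * ‖toMat h‖)
      (by linarith)
    -- Shrinking `x` to `3x/4` keeps the ball of radius `1/4` inside the unit ball. On it `‖Xz‖` is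
    -- at least `(3/4)(2/3)‖X‖ - ‖X‖/4 = ‖X‖/4`.
    refine ⟨(3 / 4 : ℝ) • x, fun z hz => ?_⟩
    rw [Metric.mem_ball, dist_eq_norm] at hz
    have hn1 : ‖(3 / 4 : ℝ) • x‖ = 3 / 4 * ‖x‖ := by rw [norm_smul]; norm_num
    refine ⟨?_, ?_⟩
    · have := norm_le_norm_add_norm_sub' z ((3 / 4 : ℝ) • x)
      show ‖z‖ < 1
      linarith
    · have h1 := norm_toLp_mulVec_sub_le (toMat h) z ((3 / 4 : ℝ) • x)
      have h2 : ‖(WithLp.toLp 2 (toMat h *ᵥ ((3 / 4 : ℝ) • x).ofLp) : EuclideanSpace ℝ (Fin n))‖ =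
          3 / 4 * ‖(WithLp.toLp 2 (toMat h *ᵥ x.ofLp) : EuclideanSpace ℝ (Fin n))‖ := by
        rw [WithLp.ofLp_smul, Matrix.mulVec_smul, WithLp.toLp_smul, norm_smul]; norm_num
      have h3 := norm_le_norm_add_norm_sub
        (WithLp.toLp 2 (toMat h *ᵥ z.ofLp) : EuclideanSpace ℝ (Fin n))
        (WithLp.toLp 2 (toMat h *ᵥ ((3 / 4 : ℝ) • x).ofLp))
      have h4 : ‖toMat h‖ * ‖z - (3 / 4 : ℝ) • x‖ ≤ ‖toMat h‖ * (1 / 4) := by gcongr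
      show s / 4 ≤ ‖(WithLp.toLp 2 (toMat h *ᵥ z.ofLp) : EuclideanSpace ℝ (Fin n))‖
      linarith
  · rintro h z ⟨hz, -⟩
    simpa using hz
  · intro z
    by_cases hz : z = 0
    · have : {t : EuclideanSpace ℝ (Fin n × Fin p) | (t, z) ∈ {q : _ × _ | ‖q.2‖ < 1} ∩ {q | s / 4 ≤
          ‖(WithLp.toLp 2 (toMat q.1 *ᵥ q.2.ofLp) : EuclideanSpace ℝ (Fin n))‖}} = ∅ := by
        refine Set.eq_empty_of_forall_notMem fun t ht => ?_
        have h2 : s / 4 ≤ ‖(WithLp.toLp 2 (toMat t *ᵥ z.ofLp) : EuclideanSpace ℝ (Fin n))‖ := ht.2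
        simp only [hz, WithLp.ofLp_zero, Matrix.mulVec_zero, WithLp.toLp_zero, norm_zero] at h2
        linarith
      rw [this, measureReal_empty]; positivity
    have hz' : 0 < ‖z‖ := norm_pos_iff.2 hz
    have h1 := stdGaussian_toMat_mulVec_eq (n := n) hz (measurableSet_Ici (a := s / 4))
    have h2 := stdGaussian_norm_sq_ge_le_exp (E := EuclideanSpace ℝ (Fin n)) ((s / 4) ^ 2)
    rw [finrank_euclideanSpace, Fintype.card_fin, div_pow, hs2,
      show -(256 * (n : ℝ) / 4 ^ 2) / 4 = -(4 * n) by ring] at h2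
    refine le_trans ?_ h2
    calc _ ≤ (stdGaussian (EuclideanSpace ℝ (Fin n × Fin p))).real {h | ‖(WithLp.toLp 2
          (toMat h *ᵥ z.ofLp) : EuclideanSpace ℝ (Fin n))‖ / ‖z‖ ∈ Set.Ici (s / 4)} := by
          refine measureReal_mono fun h hh => ?_
          rw [Set.mem_ofPred_eq, Set.mem_Ici, le_div_iff₀ hz']
          have h1 : ‖z‖ < 1 := hh.1
          have h2 : s / 4 ≤ ‖(WithLp.toLp 2 (toMat h *ᵥ z.ofLp) : EuclideanSpace ℝ (Fin n))‖ := hh.2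
          nlinarith
      _ = _ := h1
      _ ≤ _ := by
          refine measureReal_mono fun g hg => ?_
          have h3 : s / 4 ≤ ‖g‖ := hg
          show 256 * (n : ℝ) / 4 ^ 2 ≤ ‖g‖ ^ 2
          rw [← hs2, ← div_pow]
          gcongr

/-- Around a unit kernel vector, a ball of radius `η` satisfies `‖Xz‖ ≤ sη`, which for fixed `z` has
probability `O(ηⁿ)`. The volume ratio costs only `η^(-p)`, so `η^(n-p) → 0` wins because `p < n`. -/
lemma stdGaussian_det_eq_zero_and_norm_le (hpn : p < n) {s : ℝ} (hs : 0 < s) :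
    (stdGaussian (EuclideanSpace ℝ (Fin n × Fin p))).real
      ({h | ((toMat h)ᵀ * toMat h).det = 0} ∩ {h | ‖toMat h‖ ≤ s}) = 0 := by
  have hn' : (0 : ℝ) < n := by exact_mod_cast (Nat.zero_le p).trans_lt hpn
  set P := (stdGaussian (EuclideanSpace ℝ (Fin n × Fin p))).real
      ({h | ((toMat h)ᵀ * toMat h).det = 0} ∩ {h | ‖toMat h‖ ≤ s}) with hP
  set B := √(Real.exp 1 * ((2 * s) ^ 2 / n)) with hB
  have hbound : ∀ η : ℝ, 0 < η → η ≤ 1 / 2 → P ≤ B ^ n * 2 ^ p * η := by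
    intro η hη hη2
    have key := pow_mul_measure_le_of_forall_ball (E := EuclideanSpace ℝ (Fin p))
      (stdGaussian (EuclideanSpace ℝ (Fin n × Fin p)))
      (A := ({h | ((toMat h)ᵀ * toMat h).det = 0} ∩ {h | ‖toMat h‖ ≤ s}))
      (D := ({q | ‖q.2‖ < 2} ∩ {q | 1 / 2 ≤ ‖q.2‖}) ∩ {q |
        ‖(WithLp.toLp 2 (toMat q.1 *ᵥ q.2.ofLp) : EuclideanSpace ℝ (Fin n))‖ ≤ s * η})
      ((measurableSet_eq_fun (Continuous.matrix_det
        (continuous_toMat.matrix_transpose.matrix_mul continuous_toMat)).measurable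
          measurable_const).inter
        (measurableSet_le continuous_toMat.norm.measurable measurable_const))
      (((measurableSet_lt measurable_snd.norm measurable_const).inter
        (measurableSet_le measurable_const measurable_snd.norm)).inter
        (measurableSet_le continuous_toMat_mulVec.norm.measurable measurable_const))
      (r := η) (R := 2) (q := (B * η) ^ n) hη two_pos (by positivity) ?_ ?_ ?_
    · rw [finrank_euclideanSpace, Fintype.card_fin, ← hP, mul_pow] at key
      have e : η ^ n = η ^ p * η ^ (n - p) := by rw [← pow_add]; congr 1; omega
      rw [e] at key
      have h1 : P ≤ B ^ n * 2 ^ p * η ^ (n - p) :=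
        le_of_mul_le_mul_left (by linarith) (pow_pos hη p)
      refine h1.trans ?_
      gcongr
      exact pow_le_of_le_one hη.le (by linarith) (by omega)
    · rintro h ⟨hdet, hnorm⟩
      obtain ⟨v, hv0, hv⟩ := Matrix.exists_mulVec_eq_zero_iff.2 hdet
      have hXv : toMat h *ᵥ v = 0 := by
        rw [← dotProduct_self_eq_zero, Matrix.dotProduct_mulVec, ← Matrix.mulVec_transpose,
          Matrix.mulVec_mulVec, hv, zero_dotProduct]
      set v' : EuclideanSpace ℝ (Fin p) := WithLp.toLp 2 v with hv'
      have hv'0 : v' ≠ 0 := fun h0 => hv0 (by simpa [hv'] using congrArg WithLp.ofLp h0)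
      have hu : ‖(‖v'‖⁻¹ • v')‖ = 1 := by
        rw [norm_smul, norm_inv, norm_norm, inv_mul_cancel₀ (norm_ne_zero_iff.2 hv'0)]
      refine ⟨‖v'‖⁻¹ • v', fun z hz => ?_⟩
      rw [Metric.mem_ball, dist_eq_norm] at hz
      have h1 := norm_le_norm_add_norm_sub' z (‖v'‖⁻¹ • v')
      have h2 := norm_le_norm_add_norm_sub z (‖v'‖⁻¹ • v')
      have h3 := norm_toLp_mulVec_sub_le (toMat h) z (‖v'‖⁻¹ • v')
      rw [WithLp.ofLp_smul, Matrix.mulVec_smul, hv', hXv, smul_zero, WithLp.toLp_zero, sub_zero,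
        ← hv'] at h3
      refine ⟨⟨?_, ?_⟩, h3.trans ?_⟩
      · show ‖z‖ < 2
        linarith
      · show 1 / 2 ≤ ‖z‖
        linarith
      · exact mul_le_mul hnorm hz.le (norm_nonneg _) hs.le
    · rintro h z ⟨⟨hz, -⟩, -⟩
      simpa using hz
    · intro z
      by_cases hz : 1 / 2 ≤ ‖z‖
      swap
      · have : {t : EuclideanSpace ℝ (Fin n × Fin p) | (t, z) ∈ {q : _ × _ |
            ‖q.2‖ < 2} ∩ {q | 1 / 2 ≤ ‖q.2‖} ∩ {q |
            ‖(WithLp.toLp 2 (toMat q.1 *ᵥ q.2.ofLp) : EuclideanSpace ℝ (Fin n))‖ ≤ s * η}} = ∅ :=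
          Set.eq_empty_of_forall_notMem fun t ht => hz ht.1.2
        rw [this, measureReal_empty]; positivity
      have hz' : 0 < ‖z‖ := by linarith
      have h1 := stdGaussian_toMat_mulVec_eq (n := n) (norm_pos_iff.1 hz')
        (measurableSet_Iic (a := 2 * s * η))
      have h2 := stdGaussian_norm_sq_le_le_pow (E := EuclideanSpace ℝ (Fin n))
        (t := (2 * s * η) ^ 2 / n) (by positivity)
      rw [finrank_euclideanSpace, Fintype.card_fin, div_mul_cancel₀ _ hn'.ne'] at h2
      have e : √(Real.exp 1 * ((2 * s * η) ^ 2 / n)) = B * η := by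
        rw [hB, mul_pow, mul_div_right_comm, ← mul_assoc, Real.sqrt_mul (by positivity),
          Real.sqrt_sq hη.le]
      rw [e] at h2
      refine le_trans ?_ h2
      calc _ ≤ (stdGaussian (EuclideanSpace ℝ (Fin n × Fin p))).real {h | ‖(WithLp.toLp 2
            (toMat h *ᵥ z.ofLp) : EuclideanSpace ℝ (Fin n))‖ / ‖z‖ ∈ Set.Iic (2 * s * η)} := by
            refine measureReal_mono fun h hh => ?_
            rw [Set.mem_ofPred_eq, Set.mem_Iic, div_le_iff₀ hz']
            have h2 : ‖(WithLp.toLp 2 (toMat h *ᵥ z.ofLp) : EuclideanSpace ℝ (Fin n))‖ ≤ s * η :=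
              hh.2
            nlinarith [mul_pos hs hη]
        _ = _ := h1
        _ ≤ _ := by
            refine measureReal_mono fun g hg => ?_
            have h3 : ‖g‖ ≤ 2 * s * η := hg
            show ‖g‖ ^ 2 ≤ (2 * s * η) ^ 2
            gcongr
  refine le_antisymm ?_ measureReal_nonneg
  have ht : Tendsto (fun η : ℝ => B ^ n * 2 ^ p * η) (𝓝[>] 0) (𝓝 (B ^ n * 2 ^ p * 0)) :=
    (Continuous.tendsto (by fun_prop) 0).mono_left nhdsWithin_le_nhds
  rw [mul_zero] at ht
  refine ge_of_tendsto ht ?_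
  filter_upwards [Ioo_mem_nhdsGT (show (0 : ℝ) < 1 / 2 by norm_num)] with η hη
  exact hbound η hη.1 hη.2.le

/-- A Gaussian matrix with more rows than columns has full column rank almost surely. -/
lemma ae_det_toMat_ne_zero (hpn : p < n) :
    ∀ᵐ h ∂(stdGaussian (EuclideanSpace ℝ (Fin n × Fin p))), ((toMat h)ᵀ * toMat h).det ≠ 0 := by
  have h1 : ∀ k : ℕ, ∀ᵐ h ∂(stdGaussian (EuclideanSpace ℝ (Fin n × Fin p))),
      ¬ (((toMat h)ᵀ * toMat h).det = 0 ∧ ‖toMat h‖ ≤ (k + 1 : ℝ)) := fun k => by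
    rw [ae_iff]
    simp only [not_not]
    exact (measureReal_eq_zero_iff).1
      (stdGaussian_det_eq_zero_and_norm_le hpn (s := k + 1) (by positivity))
  filter_upwards [ae_all_iff.2 h1] with h hh hdet
  obtain ⟨k, hk⟩ := exists_nat_ge ‖toMat h‖
  exact hh k ⟨hdet, by linarith⟩

end Volumetric

/-! ### Concentration of the leverages -/

section Leverage

variable {n p : ℕ}

lemma abs_div_sub_div_le {a b p n ε : ℝ} (hp : 0 ≤ p) (hn : 0 < n) (hε : 0 < ε) (hε1 : ε ≤ 1)
    (ha : |a - p| < ε / 4 * p) (hb : |b - n| < ε / 4 * n) : |a / b - p / n| ≤ ε * (p / n) := by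
  obtain ⟨a1, a2⟩ := abs_lt.1 ha
  obtain ⟨b1, b2⟩ := abs_lt.1 hb
  have hb0 : 0 < b := by nlinarith
  have e : a / b - p / n = (a * n - p * b) / (b * n) := by field_simp
  have e2 : ε * (p / n) = (ε * p * b) / (b * n) := by field_simp
  rw [e, e2, abs_div, abs_of_pos (mul_pos hb0 hn)]
  gcongr
  have h1 : a * n ≤ (1 + ε / 4) * p * n := by gcongr; linarith
  have h2 : (1 - ε / 4) * p * n ≤ a * n := by gcongr; linarith
  have h3 : p * b ≤ p * ((1 + ε / 4) * n) := by gcongr; linarith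
  have h4 : p * ((1 - ε / 4) * n) ≤ p * b := by gcongr; linarith
  have hpn : 0 ≤ p * n := by positivity
  have h5 : ε * (p * ((1 - ε / 4) * n)) ≤ ε * (p * b) := by gcongr
  have h6 : 0 ≤ ε * (p * n) * (1 - ε) := by
    have : 0 ≤ 1 - ε := by linarith
    positivity
  have h7 : 0 ≤ ε * (p * n) := by positivity
  rw [abs_le]
  constructor <;> nlinarith

/-- The quadratic form of the projection matrix in any fixed direction has the law of a
leverage. -/
lemma stdGaussian_quadForm_hatMatrix_eq (i : Fin n) {u : Fin n → ℝ} (hu : u ⬝ᵥ u = 1) {A : Set ℝ}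
    (hA : MeasurableSet A) :
    (stdGaussian (EuclideanSpace ℝ (Fin n × Fin p))) {h | u ⬝ᵥ hatMatrix (toMat h) *ᵥ u ∈ A} =
      (stdGaussian (EuclideanSpace ℝ (Fin n × Fin p))) {h | hatMatrix (toMat h) i i ∈ A} := by
  -- The reflection exchanging `eᵢ` and `u`.
  set O := householder (Pi.single i (1 : ℝ) - u) with hO
  have hOT : Oᵀ = O := householder_transpose _
  have hOO : O * O = 1 := householder_mul_self _
  have hOe : O *ᵥ Pi.single i 1 = u := householder_sub_mulVec (by rw [hu]; simp)
  have hOu : O *ᵥ u = Pi.single i 1 := by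
    rw [← hOe, Matrix.mulVec_mulVec, hOO, Matrix.one_mulVec]
  obtain ⟨φ, hφ, hφO⟩ := exists_measurePreserving_toMat (n := n) (p := p) (O := O)
    (by rw [hOT, hOO])
  have hm : MeasurableSet {h : EuclideanSpace ℝ (Fin n × Fin p) |
      u ⬝ᵥ hatMatrix (toMat h) *ᵥ u ∈ A} := by
    refine Measurable.setOf (p := fun h => u ⬝ᵥ hatMatrix (toMat h) *ᵥ u ∈ A) ?_
    refine hA.mem.comp (g := (· ∈ A)) ?_
    simp only [dotProduct, Matrix.mulVec]
    exact Finset.measurable_sum _ fun j _ => (Finset.measurable_sum _ fun k _ =>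
      (measurable_hatMatrix_apply j k).mul_const _).const_mul _
  rw [← hφ.measure_preimage hm.nullMeasurableSet]
  congr 1
  ext h
  have e : u ⬝ᵥ hatMatrix (toMat (φ h)) *ᵥ u = hatMatrix (toMat h) i i := by
    rw [hφO, hatMatrix_orthogonal_mul (by rw [hOT, hOO]), hOT, ← Matrix.mulVec_mulVec, hOu,
      ← Matrix.mulVec_mulVec, Matrix.dotProduct_mulVec, ← Matrix.mulVec_transpose, hOT, hOu]
    simp
  simp only [Set.mem_preimage, Set.mem_ofPred_eq, e]

/-- Any positive constant serves: this only allows division by the mass of the directions `z ≠ 0`.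
-/
lemma stdGaussian_ne_zero_ge (hn : 0 < n) :
    1 / 2 ≤ (stdGaussian (EuclideanSpace ℝ (Fin n))).real {z | z ≠ 0} := by
  have hn' : (0 : ℝ) < n := by exact_mod_cast hn
  have h := stdGaussian_norm_sq_le_le_pow (E := EuclideanSpace ℝ (Fin n))
    (t := (Real.exp 1)⁻¹ * (1 / 2) ^ 2) (by positivity)
  rw [finrank_euclideanSpace, Fintype.card_fin, ← mul_assoc,
    mul_inv_cancel₀ (Real.exp_pos 1).ne', one_mul, Real.sqrt_sq (by norm_num)] at h
  have h2 : ((1 : ℝ) / 2) ^ n ≤ 1 / 2 := pow_le_of_le_one (by norm_num) (by norm_num) hn.ne'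
  have h3 : (stdGaussian (EuclideanSpace ℝ (Fin n))).real {z | z ≠ 0}ᶜ ≤ 1 / 2 := by
    refine le_trans (measureReal_mono fun z hz => ?_) (h.trans h2)
    have hz0 : z = 0 := not_not.1 hz
    show ‖z‖ ^ 2 ≤ _
    rw [hz0, norm_zero, zero_pow two_ne_zero]; positivity
  have hms : MeasurableSet {z : EuclideanSpace ℝ (Fin n) | z ≠ 0} :=
    (measurableSet_singleton 0).compl
  rw [probReal_compl_eq_one_sub hms] at h3
  linarith

/-- Writing the projection as `LᵀL` with orthonormal rows makes the numerator `‖Lz‖²`, a chi-square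
with `p` degrees of freedom; the denominator is one with `n`. Both concentrate. -/
lemma stdGaussian_quadForm_ratio_le (hp : p ≤ n) (hn : 0 < n) {X : Matrix (Fin n) (Fin p) ℝ}
    (hX : (Xᵀ * X).det ≠ 0) {ε : ℝ} (hε : 0 < ε) (hε1 : ε ≤ 1) :
    (stdGaussian (EuclideanSpace ℝ (Fin n))).real
      {z | ε * (p / n) < |(z.ofLp ⬝ᵥ hatMatrix X *ᵥ z.ofLp) / ‖z‖ ^ 2 - (p : ℝ) / n|} ≤
      4 * Real.exp (-(ε ^ 2 / 256) * p) := by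
  have hn' : (0 : ℝ) < n := by exact_mod_cast hn
  obtain ⟨L, hL1, hL2⟩ := exists_hatMatrix_eq hX
  have hq : ∀ z : EuclideanSpace ℝ (Fin n), z.ofLp ⬝ᵥ hatMatrix X *ᵥ z.ofLp =
      ‖(WithLp.toLp 2 (L *ᵥ z.ofLp) : EuclideanSpace ℝ (Fin p))‖ ^ 2 := fun z => by
    rw [hL2, ← Matrix.mulVec_mulVec, Matrix.dotProduct_mulVec, ← Matrix.mulVec_transpose,
      Matrix.transpose_transpose, EuclideanSpace.real_norm_sq_eq, dotProduct]
    exact Finset.sum_congr rfl fun i _ => (sq _).symm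
  have h1 := stdGaussian_abs_norm_sq_sub_le (E := EuclideanSpace ℝ (Fin p)) (ε := ε / 4)
    (by positivity) (by linarith)
  have h2 := stdGaussian_abs_norm_sq_sub_le (E := EuclideanSpace ℝ (Fin n)) (ε := ε / 4)
    (by positivity) (by linarith)
  rw [finrank_euclideanSpace, Fintype.card_fin] at h1 h2
  have hLc : Continuous fun z : EuclideanSpace ℝ (Fin n) =>
      (WithLp.toLp 2 (L *ᵥ z.ofLp) : EuclideanSpace ℝ (Fin p)) := by fun_prop
  rw [← stdGaussian_map_mulVec L hL1, measureReal_def, Measure.map_apply hLc.measurable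
    (measurableSet_le measurable_const (by fun_prop)), ← measureReal_def] at h1
  have h3 : Real.exp (-((ε / 4) ^ 2 / 16) * n) ≤ Real.exp (-((ε / 4) ^ 2 / 16) * p) := by
    rw [Real.exp_le_exp]
    have : (p : ℝ) ≤ n := by exact_mod_cast hp
    nlinarith [sq_nonneg (ε / 4)]
  have e : Real.exp (-(ε ^ 2 / 256) * p) = Real.exp (-((ε / 4) ^ 2 / 16) * p) := by
    congr 1; ring
  rw [e]
  refine le_trans (measureReal_mono ?_) ((measureReal_union_le _ _).trans
    ((add_le_add h1 h2).trans (by linarith)))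
  intro z hz
  by_contra hcon
  rw [Set.mem_union, not_or] at hcon
  obtain ⟨c1, c2⟩ := hcon
  have c1' : |‖(WithLp.toLp 2 (L *ᵥ z.ofLp) : EuclideanSpace ℝ (Fin p))‖ ^ 2 - p| < ε / 4 * p :=
    lt_of_not_ge c1
  have c2' : |‖z‖ ^ 2 - n| < ε / 4 * n := lt_of_not_ge c2
  have hz' : ε * (p / n) < |(z.ofLp ⬝ᵥ hatMatrix X *ᵥ z.ofLp) / ‖z‖ ^ 2 - (p : ℝ) / n| := hz
  rw [hq] at hz'
  exact absurd (abs_div_sub_div_le (Nat.cast_nonneg p) hn' hε hε1 c1' c2') (not_le.2 hz')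

/-- The leverages of a Gaussian matrix concentrate around `p / n`. -/
lemma stdGaussian_leverage_le (hpn : p < n) (i : Fin n) {ε : ℝ} (hε : 0 < ε) (hε1 : ε ≤ 1) :
    (stdGaussian (EuclideanSpace ℝ (Fin n × Fin p))).real
      {h | ε * (p / n) < |hatMatrix (toMat h) i i - (p : ℝ) / n|} ≤
      8 * Real.exp (-(ε ^ 2 / 256) * p) := by
  have hn : 0 < n := (Nat.zero_le p).trans_lt hpn
  set γ := stdGaussian (EuclideanSpace ℝ (Fin n × Fin p)) with hγ
  set ν := stdGaussian (EuclideanSpace ℝ (Fin n)) with hν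
  set A : Set ℝ := {q | ε * (p / n) < |q - (p : ℝ) / n|} with hAdef
  have hA : MeasurableSet A := measurableSet_lt measurable_const (by fun_prop)
  set Q : EuclideanSpace ℝ (Fin n × Fin p) × EuclideanSpace ℝ (Fin n) → ℝ :=
    fun q => (q.2.ofLp ⬝ᵥ hatMatrix (toMat q.1) *ᵥ q.2.ofLp) / ‖q.2‖ ^ 2 with hQ
  have hQm : Measurable Q := by
    refine Measurable.div ?_ (by fun_prop)
    simp only [dotProduct, Matrix.mulVec]
    refine Finset.measurable_sum _ fun j _ => Measurable.mul (by fun_prop)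
      (Finset.measurable_sum _ fun k _ => Measurable.mul ?_ (by fun_prop))
    exact (measurable_hatMatrix_apply j k).comp measurable_fst
  set D : Set (EuclideanSpace ℝ (Fin n × Fin p) × EuclideanSpace ℝ (Fin n)) :=
    Prod.snd ⁻¹' {z | z ≠ 0} ∩ Q ⁻¹' A with hD
  have hZ : MeasurableSet {z : EuclideanSpace ℝ (Fin n) | z ≠ 0} :=
    (measurableSet_singleton 0).compl
  have hDm : MeasurableSet D := (measurable_snd hZ).inter (hQm hA)
  -- For fixed `z ≠ 0`, the section has the probability of the leverage event, independent of `z`.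
  have e1 : (γ.prod ν) D = γ {h | hatMatrix (toMat h) i i ∈ A} * ν {z | z ≠ 0} := by
    rw [Measure.prod_apply_symm hDm, ← setLIntegral_const, ← lintegral_indicator hZ]
    refine lintegral_congr fun z => ?_
    by_cases hz : z ∈ {z : EuclideanSpace ℝ (Fin n) | z ≠ 0}
    · rw [Set.indicator_of_mem hz]
      have hz0 : ‖z‖ ≠ 0 := norm_ne_zero_iff.2 hz
      have hzz : z.ofLp ⬝ᵥ z.ofLp = ‖z‖ ^ 2 := by
        rw [EuclideanSpace.real_norm_sq_eq, dotProduct]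
        exact Finset.sum_congr rfl fun i _ => (sq _).symm
      rw [← stdGaussian_quadForm_hatMatrix_eq i (u := ‖z‖⁻¹ • z.ofLp)
        (by rw [smul_dotProduct, dotProduct_smul, hzz, smul_eq_mul, smul_eq_mul]; field_simp) hA]
      congr 1
      ext h
      have e : (‖z‖⁻¹ • z.ofLp) ⬝ᵥ hatMatrix (toMat h) *ᵥ (‖z‖⁻¹ • z.ofLp) = Q (h, z) := by
        rw [Matrix.mulVec_smul, smul_dotProduct, dotProduct_smul, smul_eq_mul, smul_eq_mul, hQ]
        field_simp
      simp only [Set.mem_ofPred_eq, e]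
      exact ⟨fun hh => hh.2, fun hh => ⟨hz, hh⟩⟩
    · rw [Set.indicator_of_notMem hz]
      have : (fun x => (x, z)) ⁻¹' D = ∅ := Set.eq_empty_of_forall_notMem fun h hh => hz hh.1
      rw [this, measure_empty]
  -- In the other order, for almost every fixed matrix, the chi-square ratio bound applies.
  have e2 : (γ.prod ν) D ≤ ENNReal.ofReal (4 * Real.exp (-(ε ^ 2 / 256) * p)) := by
    rw [Measure.prod_apply hDm]
    calc _ ≤ ∫⁻ _, ENNReal.ofReal (4 * Real.exp (-(ε ^ 2 / 256) * p)) ∂γ := by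
          refine lintegral_mono_ae ?_
          filter_upwards [ae_det_toMat_ne_zero (n := n) (p := p) hpn] with h hh
          rw [← ofReal_measureReal]
          refine ENNReal.ofReal_le_ofReal (le_trans (measureReal_mono ?_)
            (stdGaussian_quadForm_ratio_le hpn.le hn hh hε hε1))
          exact fun z hz => hz.2
      _ = _ := by simp
  rw [e1] at e2
  have h3 : γ.real {h | hatMatrix (toMat h) i i ∈ A} * ν.real {z | z ≠ 0} ≤
      4 * Real.exp (-(ε ^ 2 / 256) * p) := by
    have := ENNReal.toReal_mono ENNReal.ofReal_ne_top e2
    rwa [ENNReal.toReal_mul, ENNReal.toReal_ofReal (by positivity)] at this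
  have h4 := stdGaussian_ne_zero_ge hn
  have h5 : 0 ≤ γ.real {h | hatMatrix (toMat h) i i ∈ A} := measureReal_nonneg
  change γ.real {h | hatMatrix (toMat h) i i ∈ A} ≤ _
  nlinarith

end Leverage

/-! ### Spread of the rows of the projection matrix -/

section Spread

variable {n p : ℕ}

/-- The vector `u` with its `i`-th coordinate replaced by zero. -/
noncomputable def eraseCoord (i : Fin n) (u : EuclideanSpace ℝ (Fin n)) :
    EuclideanSpace ℝ (Fin n) :=
  WithLp.toLp 2 (u.ofLp - u i • Pi.single i 1)

lemma eraseCoord_same (i : Fin n) (u : EuclideanSpace ℝ (Fin n)) : eraseCoord i u i = 0 := by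
  simp [eraseCoord]

lemma eraseCoord_ne {i j : Fin n} (hj : j ≠ i) (u : EuclideanSpace ℝ (Fin n)) :
    eraseCoord i u j = u j := by
  simp [eraseCoord, hj]

lemma measurable_eraseCoord (i : Fin n) : Measurable (eraseCoord i) := by
  unfold eraseCoord
  fun_prop

lemma norm_toLp_mulVec_of_orthogonal {O : Matrix (Fin n) (Fin n) ℝ} (hO : Oᵀ * O = 1)
    (u : EuclideanSpace ℝ (Fin n)) :
    ‖(WithLp.toLp 2 (O *ᵥ u.ofLp) : EuclideanSpace ℝ (Fin n))‖ = ‖u‖ := by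
  have hsq : ∀ z : EuclideanSpace ℝ (Fin n), ‖z‖ ^ 2 = z.ofLp ⬝ᵥ z.ofLp := fun z => by
    rw [EuclideanSpace.real_norm_sq_eq, dotProduct]
    exact Finset.sum_congr rfl fun i _ => sq _
  rw [← sq_eq_sq₀ (norm_nonneg _) (norm_nonneg _), hsq, hsq, Matrix.dotProduct_mulVec,
    ← Matrix.mulVec_transpose, Matrix.mulVec_mulVec, hO, Matrix.one_mulVec]

lemma eraseCoord_mulVec {i : Fin n} {O : Matrix (Fin n) (Fin n) ℝ} (hOT : Oᵀ = O)
    (hOe : O *ᵥ Pi.single i 1 = Pi.single i 1) (u : EuclideanSpace ℝ (Fin n)) :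
    eraseCoord i (WithLp.toLp 2 (O *ᵥ u.ofLp)) =
      WithLp.toLp 2 (O *ᵥ (eraseCoord i u).ofLp) := by
  have h : (O *ᵥ u.ofLp) i = u i := by
    have h1 : (Pi.single i (1 : ℝ) : Fin n → ℝ) ⬝ᵥ O *ᵥ u.ofLp = u i := by
      rw [Matrix.dotProduct_mulVec, ← Matrix.mulVec_transpose, hOT, hOe]; simp
    rw [← h1]; simp
  simp only [eraseCoord]
  rw [h, Matrix.mulVec_sub, Matrix.mulVec_smul, hOe]

/-- Equivariance in law of a random vector under the reflections fixing the `i`-th axis. -/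
def IsReflectionInvariant {T : Type*} [MeasurableSpace T] (m : Measure T) (i : Fin n)
    (U : T → EuclideanSpace ℝ (Fin n)) : Prop :=
  ∀ O : Matrix (Fin n) (Fin n) ℝ, Oᵀ = O → O * O = 1 → O *ᵥ Pi.single i 1 = Pi.single i 1 →
    ∃ φ : T → T, MeasurePreserving φ m m ∧ ∀ t, U (φ t) = WithLp.toLp 2 (O *ᵥ (U t).ofLp)

/-- The law of the direction of the off-axis part of `U`, on the event that it is nonzero. -/
noncomputable def dirLaw {T : Type*} [MeasurableSpace T] (m : Measure T) (i : Fin n)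
    (U : T → EuclideanSpace ℝ (Fin n)) : Measure (EuclideanSpace ℝ (Fin n)) :=
  (m.restrict {t | eraseCoord i (U t) ≠ 0}).map
    fun t => ‖eraseCoord i (U t)‖⁻¹ • eraseCoord i (U t)

section Dir

set_option linter.unusedSectionVars false

variable {T : Type*} [MeasurableSpace T] {m : Measure T} [IsFiniteMeasure m] {i : Fin n}
  {U : T → EuclideanSpace ℝ (Fin n)}

instance : IsFiniteMeasure (dirLaw m i U) := by
  unfold dirLaw; infer_instance

lemma measurableSet_eraseCoord_ne (hU : Measurable U) :
    MeasurableSet {t | eraseCoord i (U t) ≠ 0} :=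
  ((measurable_eraseCoord i).comp hU) (measurableSet_singleton 0).compl

lemma measurable_dir (hU : Measurable U) :
    Measurable fun t => ‖eraseCoord i (U t)‖⁻¹ • eraseCoord i (U t) :=
  (((measurable_eraseCoord i).comp hU).norm.inv).smul ((measurable_eraseCoord i).comp hU)

lemma dirLaw_apply (hU : Measurable U) {A : Set (EuclideanSpace ℝ (Fin n))}
    (hA : MeasurableSet A) : dirLaw m i U A =
      m ({t | ‖eraseCoord i (U t)‖⁻¹ • eraseCoord i (U t) ∈ A} ∩
        {t | eraseCoord i (U t) ≠ 0}) := by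
  rw [dirLaw, Measure.map_apply (measurable_dir hU) hA,
    Measure.restrict_apply (measurable_dir hU hA)]
  rfl

lemma dirLaw_ae (hU : Measurable U) :
    ∀ᵐ u ∂(dirLaw m i U), u ∈ LinearMap.ker (EuclideanSpace.proj (𝕜 := ℝ) i).toLinearMap ∧
      ‖u‖ = 1 := by
  rw [dirLaw, ae_map_iff (measurable_dir hU).aemeasurable]
  · refine (ae_restrict_iff' (measurableSet_eraseCoord_ne hU)).2 (ae_of_all _ fun t ht => ⟨?_, ?_⟩)
    · simp [eraseCoord_same]
    · exact norm_smul_inv_norm (𝕜 := ℝ) ht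
  · refine MeasurableSet.inter (s₁ := {u | _}) (s₂ := {u | _}) ?_
      (measurableSet_eq_fun measurable_norm measurable_const)
    exact (Submodule.closed_of_finiteDimensional _).measurableSet

/-- The reflection exchanging `w` and `w'` fixes `eᵢ`, because both vectors are orthogonal to it. -/
lemma dirLaw_rotation (hU : Measurable U) (hinv : IsReflectionInvariant m i U)
    {w w' : EuclideanSpace ℝ (Fin n)} (hw : w i = 0) (hw' : w' i = 0) (h1 : ‖w‖ = 1)
    (h1' : ‖w'‖ = 1) :
    ∃ R : EuclideanSpace ℝ (Fin n) → EuclideanSpace ℝ (Fin n), Measurable R ∧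
      (dirLaw m i U).map R = dirLaw m i U ∧ ∀ u, inner ℝ (R u) w = inner ℝ u w' := by
  set O := householder (w.ofLp - w'.ofLp) with hO
  have hOT : Oᵀ = O := householder_transpose _
  have hOO : O * O = 1 := householder_mul_self _
  have hOe : O *ᵥ Pi.single i 1 = Pi.single i 1 := householder_mulVec_eq_self (by simp [hw, hw'])
  have hsq : ∀ z : EuclideanSpace ℝ (Fin n), z.ofLp ⬝ᵥ z.ofLp = ‖z‖ ^ 2 := fun z => by
    rw [EuclideanSpace.real_norm_sq_eq, dotProduct]
    exact Finset.sum_congr rfl fun i _ => (sq _).symm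
  have hOw : O *ᵥ w.ofLp = w'.ofLp := householder_sub_mulVec (by rw [hsq, hsq, h1, h1'])
  obtain ⟨φ, hφ, hφU⟩ := hinv O hOT hOO hOe
  have hR : Measurable fun u : EuclideanSpace ℝ (Fin n) =>
      (WithLp.toLp 2 (O *ᵥ u.ofLp) : EuclideanSpace ℝ (Fin n)) :=
    Continuous.measurable (by fun_prop)
  have her : ∀ t, eraseCoord i (U (φ t)) = WithLp.toLp 2 (O *ᵥ (eraseCoord i (U t)).ofLp) :=
    fun t => by rw [hφU, eraseCoord_mulVec hOT hOe]
  have hnorm : ∀ t, ‖eraseCoord i (U (φ t))‖ = ‖eraseCoord i (U t)‖ := fun t => by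
    rw [her, norm_toLp_mulVec_of_orthogonal (by rw [hOT, hOO])]
  refine ⟨_, hR, ?_, fun u => ?_⟩
  · have hS := measurableSet_eraseCoord_ne (i := i) hU
    have hpre : φ ⁻¹' {t | eraseCoord i (U t) ≠ 0} = {t | eraseCoord i (U t) ≠ 0} := by
      ext t
      simp only [Set.mem_preimage, Set.mem_ofPred_eq]
      rw [← norm_ne_zero_iff, hnorm, norm_ne_zero_iff]
    have hφS := hφ.restrict_preimage hS
    rw [hpre] at hφS
    rw [dirLaw, Measure.map_map hR (measurable_dir hU)]
    conv_rhs => rw [← hφS.map_eq, Measure.map_map (measurable_dir hU) hφS.measurable]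
    congr 1
    ext1 t
    simp only [Function.comp_apply]
    rw [hnorm, her, WithLp.ofLp_smul, Matrix.mulVec_smul, WithLp.toLp_smul]
  · simp only [EuclideanSpace.inner_eq_star_dotProduct, star_trivial]
    rw [Matrix.dotProduct_mulVec, ← Matrix.mulVec_transpose, hOT, hOw]

end Dir

/-- The off-axis directions of two reflection invariant random vectors have proportional laws. -/
lemma dirLaw_proportional {T T' : Type*} [MeasurableSpace T] [MeasurableSpace T'] {m : Measure T}
    {m' : Measure T'} [IsFiniteMeasure m] [IsFiniteMeasure m'] {i : Fin n}
    {U : T → EuclideanSpace ℝ (Fin n)} {U' : T' → EuclideanSpace ℝ (Fin n)} (hU : Measurable U)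
    (hU' : Measurable U') (h : IsReflectionInvariant m i U) (h' : IsReflectionInvariant m' i U') :
    dirLaw m' i U' Set.univ • dirLaw m i U = dirLaw m i U Set.univ • dirLaw m' i U' :=
  measure_univ_smul_eq_of_rotation_invariant _ (dirLaw_ae hU) (dirLaw_ae hU')
    (fun w hw w' hw' h1 h1' => dirLaw_rotation hU h (by simpa using hw) (by simpa using hw') h1 h1')
    (fun w hw w' hw' h1 h1' =>
      dirLaw_rotation hU' h' (by simpa using hw) (by simpa using hw') h1 h1')

/-- The `i`-th column of the projection matrix. -/
noncomputable def hatCol (i : Fin n) (h : EuclideanSpace ℝ (Fin n × Fin p)) :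
    EuclideanSpace ℝ (Fin n) :=
  WithLp.toLp 2 (hatMatrix (toMat h) *ᵥ Pi.single i 1)

lemma hatCol_apply (i j : Fin n) (h : EuclideanSpace ℝ (Fin n × Fin p)) :
    hatCol i h j = hatMatrix (toMat h) i j := by
  have : hatCol i h j = (hatMatrix (toMat h))ᵀ i j := by simp [hatCol]
  rw [this, hatMatrix_transpose]

lemma measurable_hatCol (i : Fin n) : Measurable (hatCol (p := p) i) := by
  refine (WithLp.measurable_toLp 2 _).comp (measurable_pi_lambda _ fun j => ?_)
  have : (fun h : EuclideanSpace ℝ (Fin n × Fin p) => (hatMatrix (toMat h) *ᵥ Pi.single i 1) j) =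
      fun h => hatMatrix (toMat h) j i := by
    ext h; simp
  rw [this]
  exact measurable_hatMatrix_apply j i

lemma isReflectionInvariant_hatCol (i : Fin n) :
    IsReflectionInvariant (stdGaussian (EuclideanSpace ℝ (Fin n × Fin p))) i (hatCol i) := by
  intro O hOT hOO hOe
  obtain ⟨φ, hφ, hφO⟩ := exists_measurePreserving_toMat (n := n) (p := p) (O := O)
    (by rw [hOT, hOO])
  refine ⟨φ, hφ, fun h => ?_⟩
  rw [hatCol, hφO, hatMatrix_orthogonal_mul (by rw [hOT, hOO]), hOT, ← Matrix.mulVec_mulVec, hOe,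
    ← Matrix.mulVec_mulVec]
  rfl

lemma isReflectionInvariant_id (i : Fin n) :
    IsReflectionInvariant (stdGaussian (EuclideanSpace ℝ (Fin n))) i id := by
  intro O hOT hOO _
  exact ⟨_, ⟨by fun_prop, stdGaussian_map_mulVec O (by rw [hOT, hOO])⟩, fun t => rfl⟩

/-- A truncated count of the non-negligible coordinates of `u`. -/
noncomputable def spread (u : EuclideanSpace ℝ (Fin n)) : ℝ :=
  ∑ j, min (200000 * n * u j ^ 2) 1

lemma measurable_spread : Measurable (spread : EuclideanSpace ℝ (Fin n) → ℝ) := by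
  unfold spread; fun_prop

lemma dirLaw_id_spread_le (hn : 0 < n) (i : Fin n) :
    dirLaw (stdGaussian (EuclideanSpace ℝ (Fin n))) i id {u | spread u ≤ 3 / 4 * n - 1} ≤
      ENNReal.ofReal ((1 / 2) ^ n + 2 * Real.exp (-(1 / 16) * n)) := by
  have hn' : (0 : ℝ) < n := by exact_mod_cast hn
  rw [dirLaw_apply measurable_id (measurableSet_le measurable_spread measurable_const),
    ← ofReal_measureReal]
  refine ENNReal.ofReal_le_ofReal ?_
  have h1 := stdGaussian_sum_min_le n
  have h2 := stdGaussian_abs_norm_sq_sub_le (E := EuclideanSpace ℝ (Fin n)) one_pos le_rfl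
  rw [finrank_euclideanSpace, Fintype.card_fin, one_pow, one_mul] at h2
  refine le_trans (measureReal_mono ?_) ((measureReal_union_le _ _).trans (add_le_add h1 h2))
  rintro g ⟨hg, hg0⟩
  rw [Set.mem_union]
  by_contra! hcon
  obtain ⟨c1, c2⟩ := hcon
  have c1' : 3 / 4 * (n : ℝ) < ∑ j, min (100000 * g j ^ 2) 1 := lt_of_not_ge c1
  have c2' : |‖g‖ ^ 2 - n| < n := lt_of_not_ge c2
  have hgn : ‖g‖ ^ 2 ≤ 2 * n := by linarith [(abs_lt.1 c2').2]
  have hg' : spread (‖eraseCoord i g‖⁻¹ • eraseCoord i g) ≤ 3 / 4 * n - 1 := hg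
  have hE0 : 0 < ‖eraseCoord i g‖ := norm_pos_iff.2 hg0
  have hEn : ‖eraseCoord i g‖ ^ 2 ≤ 2 * n := by
    refine le_trans ?_ hgn
    rw [EuclideanSpace.real_norm_sq_eq, EuclideanSpace.real_norm_sq_eq]
    refine Finset.sum_le_sum fun j _ => ?_
    by_cases hj : j = i
    · rw [hj, eraseCoord_same, zero_pow two_ne_zero]; positivity
    · rw [eraseCoord_ne hj]
  -- Since `‖g‖² ≤ 2n`, normalising is paid for by replacing `100000` with `200000 n`. The erased
  -- coordinate costs at most `1`.
  have hsum : ∑ j, min (100000 * g j ^ 2) 1 ≤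
      spread (‖eraseCoord i g‖⁻¹ • eraseCoord i g) + 1 := by
    rw [spread, ← Finset.add_sum_erase _ _ (Finset.mem_univ i), add_comm,
      ← Finset.add_sum_erase _ (fun j => min (200000 * n *
        (‖eraseCoord i g‖⁻¹ • eraseCoord i g).ofLp j ^ 2) 1) (Finset.mem_univ i)]
    refine add_le_add ?_ (min_le_right _ _)
    have h0 : 0 ≤ min (200000 * (n : ℝ) *
        (‖eraseCoord i g‖⁻¹ • eraseCoord i g).ofLp i ^ 2) 1 := le_min (by positivity) zero_le_one
    refine le_add_of_nonneg_of_le h0 (Finset.sum_le_sum fun j hj => min_le_min_right _ ?_)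
    rw [PiLp.smul_apply, eraseCoord_ne (Finset.ne_of_mem_erase hj), smul_eq_mul, mul_pow, inv_pow]
    rw [← mul_assoc]
    gcongr
    rw [← div_eq_mul_inv, le_div_iff₀ (by positivity)]
    linarith
  linarith

lemma dirLaw_id_univ_ge (hn : 2 ≤ n) (i : Fin n) :
    ENNReal.ofReal (1 / 2) ≤ dirLaw (stdGaussian (EuclideanSpace ℝ (Fin n))) i id Set.univ := by
  rw [dirLaw_apply measurable_id MeasurableSet.univ]
  simp only [Set.mem_univ, Set.ofPred_true, Set.univ_inter, id]
  rw [← ofReal_measureReal]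
  refine ENNReal.ofReal_le_ofReal ?_
  have hm := measurableSet_eraseCoord_ne (i := i) (U := id) measurable_id
  have h3 : (stdGaussian (EuclideanSpace ℝ (Fin n))).real
      {g | eraseCoord i g ≠ 0}ᶜ ≤ (1 / 2) ^ n := by
    refine (measureReal_mono fun g hg => ?_).trans (stdGaussian_sum_min_le n)
    have hg0 : eraseCoord i g = 0 := not_not.1 hg
    show ∑ j, min (100000 * g j ^ 2) 1 ≤ 3 / 4 * (n : ℝ)
    rw [Finset.sum_eq_single i]
    · refine (min_le_right _ _).trans ?_
      have : (2 : ℝ) ≤ n := by exact_mod_cast hn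
      linarith
    · intro j _ hj
      rw [← eraseCoord_ne hj g, hg0]; simp
    · simp
  have h4 : ((1 : ℝ) / 2) ^ n ≤ (1 / 2) ^ 2 := pow_le_pow_of_le_one (by norm_num) (by norm_num) hn
  have h5 := probReal_compl_eq_one_sub (μ := stdGaussian (EuclideanSpace ℝ (Fin n))) hm
  simp only [id] at h5
  rw [h5] at h3
  linarith

/-- The off-diagonal part of a row of the projection matrix is spread out. -/
lemma stdGaussian_spread_le (hn : 2 ≤ n) (i : Fin n) :
    (stdGaussian (EuclideanSpace ℝ (Fin n × Fin p))).real
      ({h | spread (‖eraseCoord i (hatCol i h)‖⁻¹ • eraseCoord i (hatCol i h)) ≤ 3 / 4 * n - 1} ∩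
        {h | eraseCoord i (hatCol i h) ≠ 0}) ≤
      2 * ((1 / 2) ^ n + 2 * Real.exp (-(1 / 16) * n)) := by
  have hA : MeasurableSet {u : EuclideanSpace ℝ (Fin n) | spread u ≤ 3 / 4 * n - 1} :=
    measurableSet_le measurable_spread measurable_const
  have key := dirLaw_proportional (measurable_hatCol i) measurable_id
    (isReflectionInvariant_hatCol (p := p) i) (isReflectionInvariant_id i)
  have key2 := congrArg (fun ρ : Measure _ => ρ {u | spread u ≤ 3 / 4 * (n : ℝ) - 1}) key
  simp only [Measure.smul_apply, smul_eq_mul] at key2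
  rw [dirLaw_apply (measurable_hatCol i) hA] at key2
  have h1 : dirLaw (stdGaussian (EuclideanSpace ℝ (Fin n × Fin p))) i (hatCol i) Set.univ ≤ 1 := by
    rw [dirLaw_apply (measurable_hatCol i) MeasurableSet.univ]
    exact prob_le_one
  have h2 := dirLaw_id_univ_ge hn i
  have h3 := dirLaw_id_spread_le (by omega : 0 < n) i
  set m := stdGaussian (EuclideanSpace ℝ (Fin n × Fin p))
  set B := ({h | spread (‖eraseCoord i (hatCol i h)‖⁻¹ • eraseCoord i (hatCol i h)) ≤
    3 / 4 * (n : ℝ) - 1} ∩ {h : EuclideanSpace ℝ (Fin n × Fin p) | eraseCoord i (hatCol i h) ≠ 0})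
  -- Proportionality transfers the bound from the Gaussian vector to the row of `H`, up to its
  -- direction mass, at least `1/2`.
  have h4 : ENNReal.ofReal (1 / 2) * m B ≤
      ENNReal.ofReal ((1 / 2) ^ n + 2 * Real.exp (-(1 / 16) * n)) := by
    calc _ ≤ dirLaw (stdGaussian (EuclideanSpace ℝ (Fin n))) i id Set.univ * m B := by gcongr
      _ = _ := key2
      _ ≤ 1 * _ := by gcongr
      _ = _ := one_mul _
      _ ≤ _ := h3
  rw [← ofReal_measureReal, ← ENNReal.ofReal_mul (by norm_num)] at h4
  have := (ENNReal.ofReal_le_ofReal_iff (by positivity)).1 h4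
  linarith

end Spread

/-! ### The main theorem -/

section Main

variable {n p : ℕ}

/-- As `H` is symmetric and idempotent, `∑ⱼ Hᵢⱼ² = Hᵢᵢ`; removing the diagonal term leaves `Hᵢᵢ -
Hᵢᵢ²`. -/
lemma norm_sq_eraseCoord_hatCol (i : Fin n) {h : EuclideanSpace ℝ (Fin n × Fin p)}
    (hdet : ((toMat h)ᵀ * toMat h).det ≠ 0) :
    ‖eraseCoord i (hatCol i h)‖ ^ 2 =
      hatMatrix (toMat h) i i * (1 - hatMatrix (toMat h) i i) := by
  have h1 : ∑ j, hatMatrix (toMat h) i j ^ 2 = hatMatrix (toMat h) i i := by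
    conv_rhs => rw [← hatMatrix_mul_self hdet, Matrix.mul_apply]
    refine Finset.sum_congr rfl fun j _ => ?_
    have : hatMatrix (toMat h) j i = (hatMatrix (toMat h))ᵀ i j := rfl
    rw [this, hatMatrix_transpose, sq]
  rw [EuclideanSpace.real_norm_sq_eq, ← Finset.add_sum_erase _ _ (Finset.mem_univ i),
    eraseCoord_same]
  rw [← Finset.add_sum_erase _ _ (Finset.mem_univ i)] at h1
  have h2 : ∑ j ∈ Finset.univ.erase i, eraseCoord i (hatCol i h) j ^ 2 =
      ∑ j ∈ Finset.univ.erase i, hatMatrix (toMat h) i j ^ 2 :=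
    Finset.sum_congr rfl fun j hj => by
      rw [eraseCoord_ne (Finset.ne_of_mem_erase hj), hatCol_apply]
  rw [h2]
  linarith

lemma mul_spread_le_sum_min {i : Fin n} (hn : 0 < n) {h : EuclideanSpace ℝ (Fin n × Fin p)}
    {β : ℝ} (hβ : 0 < β) (hnorm : β ≤ ‖eraseCoord i (hatCol i h)‖ ^ 2) :
    β / (200000 * n) * spread (‖eraseCoord i (hatCol i h)‖⁻¹ • eraseCoord i (hatCol i h)) ≤
      ∑ j, min (hatMatrix (toMat h) i j ^ 2) (β / (200000 * n)) := by
  have hn' : (0 : ℝ) < n := by exact_mod_cast hn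
  rw [spread, Finset.mul_sum]
  refine Finset.sum_le_sum fun j _ => ?_
  rw [mul_min_of_nonneg _ _ (by positivity), mul_one]
  refine min_le_min_right _ ?_
  have hE : eraseCoord i (hatCol i h) j ^ 2 ≤ hatMatrix (toMat h) i j ^ 2 := by
    by_cases hj : j = i
    · rw [hj, eraseCoord_same, zero_pow two_ne_zero]; positivity
    · rw [eraseCoord_ne hj, hatCol_apply]
  rw [PiLp.smul_apply, smul_eq_mul, mul_pow, inv_pow]
  have e : β / (200000 * n) * (200000 * n * ((‖eraseCoord i (hatCol i h)‖ ^ 2)⁻¹ *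
      eraseCoord i (hatCol i h) j ^ 2)) =
      β * (‖eraseCoord i (hatCol i h)‖ ^ 2)⁻¹ * eraseCoord i (hatCol i h) j ^ 2 := by
    field_simp
  rw [e]
  refine le_trans (mul_le_of_le_one_left (sq_nonneg _) ?_) hE
  rw [← div_eq_mul_inv, div_le_one (hβ.trans_le hnorm)]
  exact hnorm

lemma min_add_min_sub_le {a b τ : ℝ} : min a τ + min b τ - τ ≤ min a b := by
  rcases le_total a b with h | h
  · rw [min_eq_left h]; linarith [min_le_left a τ, min_le_right b τ]
  · rw [min_eq_right h]; linarith [min_le_left b τ, min_le_right a τ]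

/-- Each row, truncated at level `τ`, has at least the fraction `3/4 - 1/n` of the maximal mass
`nτ`. By inclusion–exclusion two rows share at least `(n/2 - 2)τ`, which is at least `nτ/4` once `n
≥ 8`. -/
lemma le_sum_min_hatMatrix (hn : 8 ≤ n) {h : EuclideanSpace ℝ (Fin n × Fin p)}
    {β : ℝ} (hβ : 0 < β) (hnorm : ∀ i, β ≤ ‖eraseCoord i (hatCol i h)‖ ^ 2)
    (hspread : ∀ i, 3 / 4 * (n : ℝ) - 1 ≤
      spread (‖eraseCoord i (hatCol i h)‖⁻¹ • eraseCoord i (hatCol i h))) (i k : Fin n) :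
    β / 800000 ≤ ∑ j, min (hatMatrix (toMat h) i j ^ 2) (hatMatrix (toMat h) k j ^ 2) := by
  have hn' : (8 : ℝ) ≤ n := by exact_mod_cast hn
  have hn0 : (0 : ℝ) < n := by linarith
  set τ := β / (200000 * n) with hτ
  have hτ0 : 0 < τ := by positivity
  have hi : ∀ i, τ * (3 / 4 * n - 1) ≤ ∑ j, min (hatMatrix (toMat h) i j ^ 2) τ := fun i =>
    (mul_le_mul_of_nonneg_left (hspread i) hτ0.le).trans
      (mul_spread_le_sum_min (by omega) hβ (hnorm i))
  have hsum : ∑ j, min (hatMatrix (toMat h) i j ^ 2) τ + ∑ j, min (hatMatrix (toMat h) k j ^ 2) τ -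
      n * τ ≤ ∑ j, min (hatMatrix (toMat h) i j ^ 2) (hatMatrix (toMat h) k j ^ 2) := by
    have : (n : ℝ) * τ = ∑ _j : Fin n, τ := by simp
    rw [this, ← Finset.sum_add_distrib, ← Finset.sum_sub_distrib]
    exact Finset.sum_le_sum fun j _ => min_add_min_sub_le
  have e : β / 800000 = τ * (n / 4) := by rw [hτ]; field_simp; norm_num
  rw [e]
  have := hi i
  have := hi k
  nlinarith

/-- The concatenation of the vectors `x₁, …, xₙ`. -/
noncomputable def stackRows (x : Fin n → EuclideanSpace ℝ (Fin p)) :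
    EuclideanSpace ℝ (Fin n × Fin p) :=
  WithLp.toLp 2 fun q => x q.1 q.2

lemma measurable_stackRows : Measurable (stackRows : (Fin n → EuclideanSpace ℝ (Fin p)) → _) := by
  unfold stackRows
  refine (WithLp.measurable_toLp 2 _).comp (measurable_pi_lambda _ fun q => ?_)
  fun_prop

lemma toMat_stackRows (x : Fin n → EuclideanSpace ℝ (Fin p)) :
    toMat (stackRows x) = Matrix.of fun i => (x i).ofLp := rfl

/-- Independence makes the joint law a product, whose characteristic function factors over the rows.
-/
lemma IsStdGaussianSample.map_stackRows {Ω : Type*} [MeasurableSpace Ω] {μ : Measure Ω}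
    [IsProbabilityMeasure μ] {x : Fin n → Ω → EuclideanSpace ℝ (Fin p)}
    (hx : IsStdGaussianSample μ x) :
    AEMeasurable (fun ω => stackRows fun i => x i ω) μ ∧
      μ.map (fun ω => stackRows fun i => x i ω) = stdGaussian _ := by
  have hae : AEMeasurable (fun ω i => x i ω) μ :=
    aemeasurable_pi_lambda _ fun i => (hx.hasLaw i).aemeasurable
  refine ⟨measurable_stackRows.comp_aemeasurable hae, ?_⟩
  have h1 := (iIndepFun_iff_map_fun_eq_pi_map fun i => (hx.hasLaw i).aemeasurable).1 hx.indep
  simp only [(hx.hasLaw _).map_eq] at h1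
  have h2 : μ.map (fun ω => stackRows fun i => x i ω) =
      (μ.map fun ω i => x i ω).map stackRows :=
    (AEMeasurable.map_map_of_aemeasurable measurable_stackRows.aemeasurable hae).symm
  have := Measure.isProbabilityMeasure_map (μ := Measure.pi fun _ : Fin n =>
    stdGaussian (EuclideanSpace ℝ (Fin p))) measurable_stackRows.aemeasurable
  rw [h2, h1]
  apply Measure.ext_of_charFun
  ext t
  rw [charFun_stdGaussian, charFun_apply, integral_map measurable_stackRows.aemeasurable
    (Measurable.aestronglyMeasurable (by fun_prop))]
  have hin : ∀ v : Fin n → EuclideanSpace ℝ (Fin p), inner ℝ (stackRows v) t =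
      ∑ i, inner ℝ (v i) (WithLp.toLp 2 fun a => t (i, a) : EuclideanSpace ℝ (Fin p)) := fun v => by
    simp [EuclideanSpace.inner_eq_star_dotProduct, dotProduct, Fintype.sum_prod_type, stackRows]
  have hnt : ‖t‖ ^ 2 =
      ∑ i, ‖(WithLp.toLp 2 fun a => t (i, a) : EuclideanSpace ℝ (Fin p))‖ ^ 2 := by
    simp [EuclideanSpace.real_norm_sq_eq, Fintype.sum_prod_type]
  simp_rw [hin, Complex.ofReal_sum, Finset.sum_mul, Complex.exp_sum]
  rw [integral_fintype_prod_eq_prod (f := fun i (v : EuclideanSpace ℝ (Fin p)) => Complex.exp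
    (inner ℝ v (WithLp.toLp 2 fun a => t (i, a) : EuclideanSpace ℝ (Fin p)) * Complex.I))]
  simp_rw [← charFun_apply, charFun_stdGaussian]
  rw [← Complex.exp_sum, ← Complex.ofReal_pow, hnt]
  push_cast
  rw [← Finset.sum_neg_distrib, Finset.sum_div]

/-- The exceptional event for a Gaussian matrix. -/
def badEvent (n p : ℕ) (ε : ℝ) : Set (EuclideanSpace ℝ (Fin n × Fin p)) :=
  {h | ((toMat h)ᵀ * toMat h).det = 0} ∪
  (⋃ i, {h | ε * (p / n) < |hatMatrix (toMat h) i i - (p : ℝ) / n|}) ∪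
  (⋃ i, {h | spread (‖eraseCoord i (hatCol i h)‖⁻¹ • eraseCoord i (hatCol i h)) ≤ 3 / 4 * n - 1} ∩
    {h | eraseCoord i (hatCol i h) ≠ 0}) ∪
  {h | ε * ((n * p : ℕ) : ℝ) ≤ |‖h‖ ^ 2 - ((n * p : ℕ) : ℝ)|} ∪
  {h | 256 * (n : ℝ) < ‖toMat h‖ ^ 2}

lemma stdGaussian_badEvent_le (hpn : p < n) (hp : 0 < p) {ε : ℝ} (hε : 0 < ε) (hε1 : ε ≤ 1) :
    (stdGaussian _).real (badEvent n p ε) ≤ 17 * n * Real.exp (-(ε ^ 2 / 256) * p) := by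
  have hp1 : (1 : ℝ) ≤ p := by exact_mod_cast hp
  have hpn' : (p : ℝ) ≤ n := by exact_mod_cast hpn.le
  have hn2 : 2 ≤ n := by omega
  set e := Real.exp (-(ε ^ 2 / 256) * p) with he
  have hsq : ε ^ 2 ≤ 1 := pow_le_one₀ hε.le hε1
  have hsq0 : 0 ≤ ε ^ 2 := sq_nonneg ε
  have hle : ε ^ 2 / 256 * p ≤ 1 / 256 * n := by nlinarith
  have b1 : (stdGaussian (EuclideanSpace ℝ (Fin n × Fin p))).real
      {h | ((toMat h)ᵀ * toMat h).det = 0} = 0 := by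
    rw [measureReal_eq_zero_iff]
    have := ae_iff.1 (ae_det_toMat_ne_zero (n := n) (p := p) hpn)
    simpa only [not_not, ne_eq] using this
  have b2 : (stdGaussian (EuclideanSpace ℝ (Fin n × Fin p))).real
      (⋃ i, {h | ε * (p / n) < |hatMatrix (toMat h) i i - (p : ℝ) / n|}) ≤ n * (8 * e) := by
    refine (measureReal_iUnion_fintype_le _).trans ?_
    refine (Finset.sum_le_sum fun i _ => stdGaussian_leverage_le hpn i hε hε1).trans ?_
    simp [he]
  have b3 : (stdGaussian (EuclideanSpace ℝ (Fin n × Fin p))).real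
      (⋃ i, {h | spread (‖eraseCoord i (hatCol i h)‖⁻¹ • eraseCoord i (hatCol i h)) ≤
        3 / 4 * n - 1} ∩ {h | eraseCoord i (hatCol i h) ≠ 0}) ≤ n * (6 * e) := by
    refine (measureReal_iUnion_fintype_le _).trans ?_
    refine (Finset.sum_le_sum fun i _ => stdGaussian_spread_le hn2 i).trans ?_
    rw [Finset.sum_const, Finset.card_univ, Fintype.card_fin, nsmul_eq_mul]
    have h1 : Real.exp (-(1 / 16) * n) ≤ e := Real.exp_le_exp.2 (by linarith)
    have h2 : ((1 : ℝ) / 2) ^ n ≤ Real.exp (-(1 / 16) * n) := by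
      rw [mul_comm, Real.exp_nat_mul]
      gcongr
      linarith [Real.add_one_le_exp (-(1 / 16 : ℝ))]
    have h3 : 2 * ((1 / 2 : ℝ) ^ n + 2 * Real.exp (-(1 / 16) * n)) ≤ 6 * e := by linarith
    exact mul_le_mul_of_nonneg_left h3 (Nat.cast_nonneg n)
  have b4 : (stdGaussian (EuclideanSpace ℝ (Fin n × Fin p))).real
      {h | ε * ((n * p : ℕ) : ℝ) ≤ |‖h‖ ^ 2 - ((n * p : ℕ) : ℝ)|} ≤ 2 * e := by
    have h1 := stdGaussian_abs_norm_sq_sub_le (E := EuclideanSpace ℝ (Fin n × Fin p)) hε hε1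
    rw [finrank_euclideanSpace, Fintype.card_prod, Fintype.card_fin, Fintype.card_fin] at h1
    refine h1.trans (mul_le_mul_of_nonneg_left (Real.exp_le_exp.2 ?_) zero_le_two)
    push_cast
    have : (p : ℝ) ≤ n * p := le_mul_of_one_le_left (by linarith) (by linarith)
    nlinarith [mul_le_mul_of_nonneg_left this hsq0, mul_nonneg hsq0 (show (0 : ℝ) ≤ p by linarith)]
  have b5 : (stdGaussian (EuclideanSpace ℝ (Fin n × Fin p))).real
      {h | 256 * (n : ℝ) < ‖toMat h‖ ^ 2} ≤ e :=
    (stdGaussian_norm_toMat_gt_le hpn.le (by omega)).trans (Real.exp_le_exp.2 (by linarith))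
  have he0 : 0 < e := Real.exp_pos _
  have hn1 : (2 : ℝ) ≤ n := by exact_mod_cast hn2
  -- The total is at most `(8 + 6) n e + 2 e + e ≤ 17 n e`.
  refine (measureReal_union_le _ _).trans ((add_le_add (measureReal_union_le _ _) b5).trans ?_)
  have u2 := measureReal_union_le (μ := stdGaussian (EuclideanSpace ℝ (Fin n × Fin p)))
    ({h | ((toMat h)ᵀ * toMat h).det = 0} ∪
      (⋃ i, {h | ε * (p / n) < |hatMatrix (toMat h) i i - (p : ℝ) / n|}))
    (⋃ i, {h | spread (‖eraseCoord i (hatCol i h)‖⁻¹ • eraseCoord i (hatCol i h)) ≤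
        3 / 4 * n - 1} ∩ {h | eraseCoord i (hatCol i h) ≠ 0})
  have u3 := measureReal_union_le (μ := stdGaussian (EuclideanSpace ℝ (Fin n × Fin p)))
    {h | ((toMat h)ᵀ * toMat h).det = 0}
    (⋃ i, {h | ε * (p / n) < |hatMatrix (toMat h) i i - (p : ℝ) / n|})
  nlinarith

/-- Off the exceptional event, Tyler's estimator is well defined and close to the sample
covariance. -/
lemma tyler_of_notMem_badEvent (hn : 8 ≤ n) (hp : 0 < p) {y₁ d ε β : ℝ} (hy₁ : 0 < y₁)
    (hy₁r : y₁ ≤ (p : ℝ) / n) (hd : 0 < d) (hrd : (p : ℝ) / n ≤ 1 - d) (hε : 0 < ε)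
    (hε2 : ε ≤ d / 2) (hβ : β = y₁ * d / 4) (hεβ : 16 * ε < (β / 800000) ^ 2)
    {x : Fin n → EuclideanSpace ℝ (Fin p)} (hx : stackRows x ∉ badEvent n p ε) :
    HasTylerEstimator x ∧
      ‖(p : ℝ) • tylerEstimator x - sampleCovariance x‖ ≤
        2 * (2 * ε / (β / 800000) + ε) * 256 := by
  have hn' : (0 : ℝ) < n := by exact_mod_cast (by omega : 0 < n)
  set r := (p : ℝ) / n with hr
  simp only [badEvent, Set.mem_union, not_or, Set.mem_iUnion, not_exists] at hx
  obtain ⟨⟨⟨⟨x1, x2⟩, x3⟩, x4⟩, x5⟩ := hx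
  have hdet : ((toMat (stackRows x))ᵀ * toMat (stackRows x)).det ≠ 0 := x1
  have hlev : ∀ i, |hatMatrix (toMat (stackRows x)) i i - r| ≤ ε * r := fun i => not_lt.1 (x2 i)
  have hd1 : d ≤ 1 := by
    have : 0 ≤ r := by positivity
    linarith
  have hr1 : r ≤ 1 := by linarith
  -- The diagonal entry is at least `y₁/2` and its complement at least `d/2`, whence `β = y₁ d / 4`.
  have hnorm : ∀ i, β ≤ ‖eraseCoord i (hatCol i (stackRows x))‖ ^ 2 := fun i => by
    rw [norm_sq_eraseCoord_hatCol i hdet, hβ]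
    obtain ⟨l1, l2⟩ := abs_le.1 (hlev i)
    have a1 : y₁ / 2 ≤ hatMatrix (toMat (stackRows x)) i i := by nlinarith
    have a2 : d / 2 ≤ 1 - hatMatrix (toMat (stackRows x)) i i := by nlinarith
    nlinarith [mul_le_mul a1 a2 (by positivity) (by linarith)]
  have hβ0 : 0 < β := by rw [hβ]; positivity
  have hβ1 : β ≤ 1 := by rw [hβ]; nlinarith
  have hspread : ∀ i, 3 / 4 * (n : ℝ) - 1 ≤
      spread (‖eraseCoord i (hatCol i (stackRows x))‖⁻¹ •
        eraseCoord i (hatCol i (stackRows x))) := fun i => by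
    by_contra! hcon
    refine x3 i ⟨hcon.le, fun h0 => ?_⟩
    have := hnorm i
    rw [h0, norm_zero] at this
    norm_num at this
    linarith
  have hc := le_sum_min_hatMatrix hn hβ0 hnorm hspread
  have htr : |(wgram (fun i => (x i).ofLp) 1).trace - n * p| ≤ ε * (n * p) := by
    have h4 : |‖stackRows x‖ ^ 2 - ((n * p : ℕ) : ℝ)| ≤ ε * ((n * p : ℕ) : ℝ) :=
      (lt_of_not_ge x4).le
    push_cast at h4
    have : (wgram (fun i => (x i).ofLp) 1).trace = ‖stackRows x‖ ^ 2 := by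
      rw [wgram_trace, EuclideanSpace.real_norm_sq_eq, Fintype.sum_prod_type]
      simp [stackRows, dotProduct, sq]
    rwa [this]
  have hlt : ε * r < r := by
    have : 0 < r := by linarith
    nlinarith
  have hεr : ε * r ≤ ε := by nlinarith
  rw [toMat_stackRows] at hdet hlev hc
  have hmain := hasTylerEstimator_and_norm_sub_le (x := x) (by omega) hp
    (by
      have : (p : ℝ) ≤ n := (div_le_one hn').1 hr1
      exact_mod_cast this)
    (η := ε * r) (η' := ε) (c := β / 800000) (K := 256)
    (by rw [wgram_one]; exact hdet)
    (fun i => by rw [lev_one_eq_hatMatrix]; exact hlev i) (by positivity) hlt (by positivity)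
    (by linarith)
    (fun i k _ => by simp only [lev_one_eq_hatMatrix]; exact hc i k) (by linarith) htr hε.le
    (by nlinarith) (by rw [← toMat_stackRows]; exact not_lt.1 x5)
  refine ⟨hmain.1, hmain.2.trans ?_⟩
  gcongr

end Main

/-- Concentration of Tyler's estimator around the sample covariance, uniformly over aspect ratios
near `y`. -/
lemma exists_tyler_rate (y : ℝ) (hy0 : 0 < y) (hy1 : y < 1) :
    ∃ C c c' δ : ℝ, 0 < C ∧ 0 < c ∧ 0 < c' ∧ 0 < δ ∧
      ∀ n p : ℕ, 0 < n → |(p : ℝ) / (n : ℝ) - y| < δ →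
      ∀ (Ω : Type u) [MeasurableSpace Ω] (μ : Measure Ω) [IsProbabilityMeasure μ]
        (x : Fin n → Ω → EuclideanSpace ℝ (Fin p)), IsStdGaussianSample μ x →
      ∀ ε : ℝ, 0 < ε → ε < c' →
        μ.real {ω | ¬ (HasTylerEstimator (fun i => x i ω) ∧
            ‖(p : ℝ) • tylerEstimator (fun i => x i ω) - sampleCovariance (fun i => x i ω)‖ ≤ ε)}
          ≤ C * (n : ℝ) * Real.exp (-c * ε ^ 2 * (n : ℝ)) := by
  set y₁ := y / 2 with hy₁
  set d := (1 - y) / 2 with hd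
  have hy₁0 : 0 < y₁ := by linarith
  have hd0 : 0 < d := by linarith
  have hy₁1 : y₁ ≤ 1 := by linarith
  have hd1 : d ≤ 1 := by linarith
  set c := y₁ * d / 4 / 800000 with hc
  have hc0 : 0 < c := by positivity
  have hyd : y₁ * d ≤ d := mul_le_of_le_one_left hd0.le hy₁1
  have hcd : c ≤ d / 3200000 := by rw [hc]; linarith
  have hc1 : c ≤ 1 := by linarith
  refine ⟨17, y₁ * c ^ 2 / (256 * 1536 ^ 2), c, min y₁ d, by norm_num, by positivity, hc0,
    lt_min hy₁0 hd0, ?_⟩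
  intro n p hn hnp Ω _ μ _ x hx ε hε hεc
  have hn' : (1 : ℝ) ≤ n := by exact_mod_cast hn
  obtain ⟨r1, r2⟩ := abs_lt.1 hnp
  have hr1 : y₁ ≤ (p : ℝ) / n := by linarith [min_le_left y₁ d]
  have hr2 : (p : ℝ) / n ≤ 1 - d := by linarith [min_le_right y₁ d]
  have hp : 0 < p := by
    rcases Nat.eq_zero_or_pos p with h | h
    · rw [h, Nat.cast_zero, zero_div] at hr1; linarith
    · exact h
  have hpn : p < n := by
    have : (p : ℝ) / n < 1 := by linarith
    rw [div_lt_one (by linarith)] at this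
    exact_mod_cast this
  have hε1 : ε < 1 := by linarith
  -- For `n < 8` the claimed bound exceeds `1`.
  by_cases h8 : 8 ≤ n
  swap
  · refine measureReal_le_one.trans ?_
    have hn8 : (n : ℝ) ≤ 8 := by exact_mod_cast (by omega : n ≤ 8)
    have h1 : y₁ * c ^ 2 / (256 * 1536 ^ 2) * ε ^ 2 * n ≤ 1 / 256 * 1 * 8 := by
      gcongr
      · have : y₁ * c ^ 2 ≤ 1 := mul_le_one₀ hy₁1 (by positivity) (pow_le_one₀ hc0.le hc1)
        exact this
      · norm_num
      · exact pow_le_one₀ hε.le hε1.le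
    have h2 := Real.add_one_le_exp (-(y₁ * c ^ 2 / (256 * 1536 ^ 2)) * ε ^ 2 * n)
    have h3 : (1 : ℝ) / 2 ≤ Real.exp (-(y₁ * c ^ 2 / (256 * 1536 ^ 2)) * ε ^ 2 * n) := by linarith
    nlinarith
  -- Then the deterministic error `2 (2ε₀/c + ε₀) · 256` equals `(2/3 + c/3) ε ≤ ε`.
  set ε₀ := c * ε / 1536 with hε₀
  have hε₀0 : 0 < ε₀ := by positivity
  have hcε : c * ε ≤ c * c := by gcongr
  have hcc : c * c ≤ c := mul_le_of_le_one_left hc0.le hc1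
  obtain ⟨hae, hmap⟩ := hx.map_stackRows
  have hsub : {ω | ¬ (HasTylerEstimator (fun i => x i ω) ∧
      ‖(p : ℝ) • tylerEstimator (fun i => x i ω) - sampleCovariance (fun i => x i ω)‖ ≤ ε)} ⊆
      (fun ω => stackRows fun i => x i ω) ⁻¹' badEvent n p ε₀ := by
    intro ω hω
    by_contra hbad
    refine hω ?_
    have h := tyler_of_notMem_badEvent h8 hp (y₁ := y₁) (d := d) (ε := ε₀) (β := y₁ * d / 4) hy₁0
      hr1 hd0 hr2 hε₀0 (by rw [hε₀]; linarith) rfl (by rw [← hc, hε₀]; nlinarith) hbad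
    refine ⟨h.1, h.2.trans ?_⟩
    rw [← hc, hε₀]
    have e : 2 * (2 * (c * ε / 1536) / c + c * ε / 1536) * 256 = (2 / 3 + c / 3) * ε := by
      field_simp; ring
    rw [e]
    nlinarith
  -- This direction of the pushforward inequality holds for arbitrary sets, so no event needs to be
  -- measurable.
  have h1 : μ.real ((fun ω => stackRows fun i => x i ω) ⁻¹' badEvent n p ε₀) ≤
      (stdGaussian _).real (badEvent n p ε₀) := by
    rw [measureReal_def, measureReal_def, ← hmap]
    refine ENNReal.toReal_mono ?_ (Measure.le_map_apply hae _)
    rw [hmap]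
    exact measure_ne_top _ _
  refine (measureReal_mono hsub).trans (h1.trans ((stdGaussian_badEvent_le hpn hp hε₀0
    (by rw [hε₀]; linarith)).trans ?_))
  refine mul_le_mul_of_nonneg_left (Real.exp_le_exp.2 ?_) (by positivity)
  have hpy : y₁ * n ≤ p := (le_div_iff₀ (by linarith)).1 hr1
  have e : -(y₁ * c ^ 2 / (256 * 1536 ^ 2)) * ε ^ 2 * n = -(ε₀ ^ 2 / 256) * (y₁ * n) := by
    rw [hε₀]; ring
  rw [e]
  have : ε₀ ^ 2 / 256 * (y₁ * n) ≤ ε₀ ^ 2 / 256 * p := by gcongr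
  linarith

/-- Strict monotonicity makes the series a subseries of `∑ m e^(-cm)`. -/
lemma summable_mul_exp_neg_mul_comp {n : ℕ → ℕ} (hn : StrictMono n) {C c : ℝ} (hc : 0 < c) :
    Summable fun k => C * (n k : ℝ) * Real.exp (-c * (n k : ℝ)) := by
  have h := (Real.summable_pow_mul_exp_neg_nat_mul 1 hc).mul_left C
  have h2 := h.comp_injective hn.injective
  refine h2.congr fun k => ?_
  simp [mul_assoc]

theorem mainTheorem2 (y : ℝ) (hy0 : 0 < y) (hy1 : y < 1) :
    -- The rate: the exceptional event contains the event that the estimator is not well defined;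
    -- `δ` makes the constants uniform over all aspect ratios near `y`, in particular `p / n = y`.
    (∃ C c c' δ : ℝ, 0 < C ∧ 0 < c ∧ 0 < c' ∧ 0 < δ ∧
      ∀ n p : ℕ, 0 < n → |(p : ℝ) / (n : ℝ) - y| < δ →
      ∀ (Ω : Type u) [MeasurableSpace Ω] (μ : Measure Ω) [IsProbabilityMeasure μ]
        (x : Fin n → Ω → EuclideanSpace ℝ (Fin p)), IsStdGaussianSample μ x →
      ∀ ε : ℝ, 0 < ε → ε < c' →
        μ.real {ω | ¬ (HasTylerEstimator (fun i => x i ω) ∧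
            ‖(p : ℝ) • tylerEstimator (fun i => x i ω) - sampleCovariance (fun i => x i ω)‖ ≤ ε)}
          ≤ C * (n : ℝ) * Real.exp (-c * ε ^ 2 * (n : ℝ))) ∧
    -- Almost sure convergence, for any joint law of the samples of different sizes.
    (∀ n p : ℕ → ℕ, StrictMono n →
      Tendsto (fun k => (p k : ℝ) / (n k : ℝ)) atTop (𝓝 y) →
      ∀ (Ω : Type u) [MeasurableSpace Ω] (μ : Measure Ω) [IsProbabilityMeasure μ]
        (x : ∀ k, Fin (n k) → Ω → EuclideanSpace ℝ (Fin (p k))),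
        (∀ k, IsStdGaussianSample μ (x k)) →
      ∀ᵐ ω ∂μ,
        (∀ᶠ k in atTop, HasTylerEstimator (fun i => x k i ω)) ∧
        Tendsto (fun k => ‖(p k : ℝ) • tylerEstimator (fun i => x k i ω)
            - sampleCovariance (fun i => x k i ω)‖) atTop (𝓝 0)) := by
  obtain ⟨C, c, c', δ, hC, hc, hc', hδ, H⟩ := exists_tyler_rate.{u} y hy0 hy1
  refine ⟨⟨C, c, c', δ, hC, hc, hc', hδ, H⟩, ?_⟩
  intro n p hn hnp Ω _ μ _ x hx
  have hev : ∀ᶠ k in atTop, 0 < n k ∧ |(p k : ℝ) / (n k : ℝ) - y| < δ := by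
    refine (eventually_gt_atTop 0).mono (fun k hk => (Nat.zero_le _).trans_lt (hn hk)) |>.and ?_
    simpa [Real.dist_eq] using hnp.eventually (Metric.ball_mem_nhds y hδ)
  have has : ∀ j : ℕ, ∀ᵐ ω ∂μ, ∀ᶠ k in atTop, HasTylerEstimator (fun i => x k i ω) ∧
      ‖(p k : ℝ) • tylerEstimator (fun i => x k i ω) - sampleCovariance (fun i => x k i ω)‖ ≤
        c' / (j + 2) := fun j => by
    -- The shift by `2` keeps every level strictly below `c'`, including `j = 0`.
    set ε := c' / (j + 2 : ℝ) with hε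
    have hε0 : 0 < ε := by positivity
    have hεc : ε < c' := div_lt_self hc' (by linarith [(Nat.cast_nonneg j : (0 : ℝ) ≤ j)])
    obtain ⟨K, hK⟩ := eventually_atTop.1 hev
    have hsum := summable_mul_exp_neg_mul_comp hn (C := C) (mul_pos hc (pow_pos hε0 2))
    set s : ℕ → Set Ω := fun k => {ω | ¬ (HasTylerEstimator (fun i => x k i ω) ∧
      ‖(p k : ℝ) • tylerEstimator (fun i => x k i ω) - sampleCovariance (fun i => x k i ω)‖ ≤ ε)}
      with hs
    have hle : ∀ k, μ (s (k + K)) ≤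
        ENNReal.ofReal (C * (n (k + K) : ℝ) * Real.exp (-(c * ε ^ 2) * (n (k + K) : ℝ))) := by
      intro k
      have h := H (n (k + K)) (p (k + K)) (hK _ (by omega)).1 (hK _ (by omega)).2 Ω μ
        (x (k + K)) (hx _) ε hε0 hεc
      rw [← ofReal_measureReal]
      refine ENNReal.ofReal_le_ofReal (h.trans (le_of_eq ?_))
      rw [neg_mul]
    have hfin : ∑' k, μ (s (k + K)) ≠ ⊤ := by
      refine ne_top_of_le_ne_top ?_ (ENNReal.tsum_le_tsum hle)
      exact ((summable_nat_add_iff K).2 hsum).tsum_ofReal_ne_top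
    -- The first Borel–Cantelli lemma requires no independence, so the joint law across sample sizes
    -- is arbitrary.
    have hbc := ae_eventually_notMem hfin
    filter_upwards [hbc] with ω hω
    have := (tendsto_sub_atTop_nat K).eventually hω
    filter_upwards [this, eventually_ge_atTop K] with k hk hkK
    rw [Nat.sub_add_cancel hkK] at hk
    exact not_not.1 hk
  filter_upwards [ae_all_iff.2 has] with ω hω
  refine ⟨(hω 0).mono fun k hk => hk.1, ?_⟩
  rw [Metric.tendsto_atTop]
  intro e he
  obtain ⟨j, hj⟩ := exists_nat_gt (c' / e)
  obtain ⟨N, hN⟩ := eventually_atTop.1 (hω j)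
  refine ⟨N, fun k hk => ?_⟩
  rw [Real.dist_0_eq_abs, abs_of_nonneg (norm_nonneg _)]
  refine (hN k hk).2.trans_lt ?_
  rw [div_lt_iff₀ he] at hj
  rw [div_lt_iff₀ (by positivity)]
  nlinarith
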